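/- Let $q\in\mathbb C^\times$ be not a root of unity. Let $\mathcal S_q$ be the Lie algebra (with commutator bracket) of the associative algebra of finite sums $\sum_k z^k f_k(T_q)$, $f_k\in\mathbb C[w,w^{-1}]$, with product $(z^mf(T_q))(z^kg(T_q))=z^{m+k}f(q^kT_q)g(T_q)$; let $\mathcal S_q'=[\mathcal S_q,\mathcal S_q]$ and let $\hat{\mathcal S}_q=\mathcal S_q'+\mathbb C C$ be its central extension by the $2$-cocycle $$\Psi(z^mf(T_q),z^kg(T_q))=m\,\delta_{m,-k}\,\mathrm{tr}_0\big(f(q^{-m}w)g(w)\big),\qquad \mathrm{tr}_0\Big(\sum_j c_jw^j\Big)=c_0,$$ with the $\mathbb Z$-gradation in which $z^kf(T_q)$ has degree $k$ and $C$ has degree $0$. For a linear functional $\lambda$ on $(\hat{\mathcal S}_q)_0$ let $L(\lambda)=\bigoplus_j L(\lambda)_j$ be the irreducible graded highest weight module over $\hat{\mathcal S}_q$ with highest weight $\lambda$, i.e. the quotient of the Verma module by its maximal graded submodule, and let $v_\lambda$ be its highest weight vector; $L(\lambda)$ is called quasifinite if $\dim L(\lambda)_j<\infty$ for all $j$. Put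 $\Delta_n=\lambda(T_q^n)$ for $n\in\mathbb Z\setminus\{0\}$, $c=\lambda(C)$, and $\Delta_\lambda(x)=\sum_{n\ne0}\Delta_nx^{-n}$, a formal series infinite in both directions. (a) Each of the following two conditions is equivalent to $L(\lambda)$ being quasifinite: (i) there is a nonzero polynomial $b(x)\in\mathbb C[x]$ such that $$b(x)\big(\Delta_\lambda(x)-\Delta_\lambda(q^{-1}x)+c\big)=0;\qquad(\ast)$$ (ii) there is a quasipolynomial $P$, i.e. a finite linear combination of functions $p(x)e^{\alpha x}$ on $\mathbb C$ with $p\in\mathbb C[x]$ and $\alpha\in\mathbb C$, such that $(1-q^n)\Delta_n=P(n)$ for all integers $n\neq0$ and $c=P(0)$. (b) If $L(\lambda)$ is quasifinite, then there is exactly one monic polynomial of minimal degree satisfying $(\ast)$, there is exactly one characteristic polynomial of $L(\lambda)$, i.e. monic polynomial $b$ of minimal degree with $(z^{-1}b(T_q))v_\lambda=0$, and the two coincide. -/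

import Mathlib

open scoped LaurentPolynomial Polynomial

noncomputable section

/-! ## The associative algebra of quantum pseudo-differential operators -/

namespace QPDO

/-- The algebra automorphism `f(w) ↦ f(a w)` of `ℂ[w, w⁻¹]`, as an algebra homomorphism. -/
def dilate (a : ℂˣ) : ℂ[T;T⁻¹] →ₐ[ℂ] ℂ[T;T⁻¹] :=
  AddMonoidAlgebra.lift ℂ ℂ[T;T⁻¹] ℤ
    { toFun := fun n => ((a ^ n.toAdd : ℂˣ) : ℂ) • LaurentPolynomial.T n.toAdd
      map_one' := by simp
      map_mul' := fun m n => by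
        rw [toAdd_mul, zpow_add, LaurentPolynomial.T_add, smul_mul_smul_comm, Units.val_mul] }

theorem dilate_coeff (a : ℂˣ) (f : ℂ[T;T⁻¹]) (n : ℤ) :
    (dilate a f).coeff n = ((a ^ n : ℂˣ) : ℂ) * f.coeff n := by
  induction f using LaurentPolynomial.induction_on' with
  | add p q hp hq => simp [hp, hq, mul_add]
  | C_mul_T m c =>
    rw [← LaurentPolynomial.single_eq_C_mul_T, dilate, AddMonoidAlgebra.lift_single]
    by_cases h : m = n
    · subst h
      simp only [MonoidHom.coe_mk, OneHom.coe_mk, toAdd_ofAdd, AddMonoidAlgebra.coeff_smul,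
        Finsupp.smul_apply, LaurentPolynomial.T_apply, AddMonoidAlgebra.coeff_single,
        Finsupp.single_eq_same, if_true, smul_eq_mul]
      ring
    · simp only [MonoidHom.coe_mk, OneHom.coe_mk, toAdd_ofAdd, AddMonoidAlgebra.coeff_smul,
        Finsupp.smul_apply, LaurentPolynomial.T_apply, AddMonoidAlgebra.coeff_single,
        Finsupp.single_apply, h, if_false, smul_eq_mul, mul_zero]

theorem dilate_one (f : ℂ[T;T⁻¹]) : dilate 1 f = f := by
  ext n; simp [dilate_coeff]

theorem dilate_dilate (a b : ℂˣ) (f : ℂ[T;T⁻¹]) : dilate a (dilate b f) = dilate (a * b) f := by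
  ext n; simp [dilate_coeff, mul_zpow, mul_assoc]

/-- The algebra `𝒮ᵃ_q`: finite sums `∑ₖ zᵏ fₖ(w)` with `fₖ ∈ ℂ[w, w⁻¹]`, where `w` stands for the
operator `T_q`. The finitely supported function `k ↦ fₖ` encodes this sum. -/
structure SAssoc (q : ℂˣ) where
  /-- The family `k ↦ fₖ`. -/
  coeffs : ℤ →₀ ℂ[T;T⁻¹]

namespace SAssoc

variable {q : ℂˣ}

/-- The bijection between elements of `𝒮ᵃ_q` and their families of coefficients. -/
def equivCoeffs : SAssoc q ≃ (ℤ →₀ ℂ[T;T⁻¹]) where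
  toFun := coeffs
  invFun := mk

instance : AddCommGroup (SAssoc q) := equivCoeffs.addCommGroup
instance : Module ℂ (SAssoc q) := equivCoeffs.module ℂ

theorem coeffs_add (F G : SAssoc q) : (F + G).coeffs = F.coeffs + G.coeffs := rfl
theorem coeffs_zero : (0 : SAssoc q).coeffs = 0 := rfl
theorem coeffs_smul (c : ℂ) (F : SAssoc q) : (c • F).coeffs = c • F.coeffs := rfl

/-- The linear map `f ↦ zᵏ f(T_q)`. -/
def mono (q : ℂˣ) (k : ℤ) : ℂ[T;T⁻¹] →ₗ[ℂ] SAssoc q where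
  toFun f := ⟨Finsupp.single k f⟩
  map_add' f g := congrArg mk (Finsupp.single_add k f g)
  map_smul' c f := congrArg mk (Finsupp.smul_single c k f).symm

/-- The coefficient `fₖ` of `∑ₖ zᵏ fₖ(T_q)`. -/
def coef (k : ℤ) : SAssoc q →ₗ[ℂ] ℂ[T;T⁻¹] where
  toFun F := F.coeffs k
  map_add' _ _ := rfl
  map_smul' _ _ := rfl

theorem coeffs_mono (k : ℤ) (f : ℂ[T;T⁻¹]) : (mono q k f).coeffs = Finsupp.single k f := rfl

theorem coef_mono (k j : ℤ) (f : ℂ[T;T⁻¹]) :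
    coef j (mono q k f) = if k = j then f else 0 := Finsupp.single_apply

/-- The product, determined by `(zᵏ f(w)) (zᵐ g(w)) = zᵏ⁺ᵐ f(qᵐ w) g(w)`. -/
def mul (F G : SAssoc q) : SAssoc q :=
  F.coeffs.sum fun k f => G.coeffs.sum fun m g => mono q (k + m) (dilate (q ^ m) f * g)

instance : Mul (SAssoc q) := ⟨mul⟩
instance : One (SAssoc q) := ⟨mono q 0 1⟩

theorem mul_def (F G : SAssoc q) : F * G =
    F.coeffs.sum fun k f => G.coeffs.sum fun m g => mono q (k + m) (dilate (q ^ m) f * g) := rfl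

theorem mono_mul_mono (k m : ℤ) (f g : ℂ[T;T⁻¹]) :
    mono q k f * mono q m g = mono q (k + m) (dilate (q ^ m) f * g) := by
  rw [mul_def, coeffs_mono, coeffs_mono, Finsupp.sum_single_index, Finsupp.sum_single_index]
  · simp
  · simp

protected theorem add_mul (F G H : SAssoc q) : (F + G) * H = F * H + G * H := by
  rw [mul_def, mul_def, mul_def, coeffs_add]
  apply Finsupp.sum_add_index'
  · intro k; simp
  · intro k f g
    rw [← Finsupp.sum_add]
    simp [add_mul]

protected theorem mul_add (F G H : SAssoc q) : F * (G + H) = F * G + F * H := by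
  rw [mul_def, mul_def, mul_def, ← Finsupp.sum_add]
  refine Finsupp.sum_congr fun k _ => ?_
  rw [coeffs_add]
  apply Finsupp.sum_add_index'
  · intro m; simp
  · intro m f g; simp [mul_add]

protected theorem zero_mul (F : SAssoc q) : 0 * F = 0 := by
  rw [mul_def, coeffs_zero, Finsupp.sum_zero_index]

protected theorem mul_zero (F : SAssoc q) : F * 0 = 0 := by
  have := SAssoc.mul_add F 0 0
  simpa using this

@[elab_as_elim]
theorem induction {P : SAssoc q → Prop} (F : SAssoc q) (h0 : P 0)
    (hadd : ∀ F G, P F → P G → P (F + G)) (hmono : ∀ k f, P (mono q k f)) : P F := by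
  obtain ⟨F⟩ := F
  induction F using Finsupp.induction_linear with
  | zero => exact h0
  | add F G hF hG => exact hadd _ _ hF hG
  | single k f => exact hmono k f

protected theorem mul_assoc (F G H : SAssoc q) : F * G * H = F * (G * H) := by
  induction F using induction with
  | h0 => simp [SAssoc.zero_mul]
  | hadd F₁ F₂ h₁ h₂ => simp [SAssoc.add_mul, h₁, h₂]
  | hmono k f =>
  induction G using induction with
  | h0 => simp [SAssoc.zero_mul, SAssoc.mul_zero]
  | hadd F₁ F₂ h₁ h₂ => simp [SAssoc.add_mul, SAssoc.mul_add, h₁, h₂]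
  | hmono l g =>
  induction H using induction with
  | h0 => simp [SAssoc.mul_zero]
  | hadd F₁ F₂ h₁ h₂ => simp [SAssoc.mul_add, h₁, h₂]
  | hmono m h =>
  simp only [mono_mul_mono, map_mul, dilate_dilate, add_assoc, zpow_add, mul_assoc]
  rw [mul_comm (q ^ l)]

protected theorem one_mul (F : SAssoc q) : 1 * F = F := by
  induction F using induction with
  | h0 => simp [SAssoc.mul_zero]
  | hadd F₁ F₂ h₁ h₂ => simp [SAssoc.mul_add, h₁, h₂]
  | hmono k f =>
  change mono q 0 1 * mono q k f = _
  simp [mono_mul_mono]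

protected theorem mul_one (F : SAssoc q) : F * 1 = F := by
  induction F using induction with
  | h0 => simp [SAssoc.zero_mul]
  | hadd F₁ F₂ h₁ h₂ => simp [SAssoc.add_mul, h₁, h₂]
  | hmono k f =>
  change mono q k f * mono q 0 1 = _
  simp [mono_mul_mono, dilate_one]

instance : Ring (SAssoc q) :=
  { (inferInstance : AddCommGroup (SAssoc q)) with
    left_distrib := SAssoc.mul_add
    right_distrib := SAssoc.add_mul
    zero_mul := SAssoc.zero_mul
    mul_zero := SAssoc.mul_zero
    mul_assoc := SAssoc.mul_assoc
    one_mul := SAssoc.one_mul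
    mul_one := SAssoc.mul_one }

protected theorem smul_mul (c : ℂ) (F G : SAssoc q) : c • F * G = c • (F * G) := by
  induction F using induction with
  | h0 => simp
  | hadd F₁ F₂ h₁ h₂ => simp only [smul_add, add_mul, h₁, h₂]
  | hmono k f =>
  induction G using induction with
  | h0 => simp
  | hadd F₁ F₂ h₁ h₂ => simp only [smul_add, mul_add, h₁, h₂]
  | hmono l g =>
  rw [← map_smul, mono_mul_mono, mono_mul_mono, ← map_smul, map_smul, smul_mul_assoc]

protected theorem mul_smul (c : ℂ) (F G : SAssoc q) : F * c • G = c • (F * G) := by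
  induction F using induction with
  | h0 => simp
  | hadd F₁ F₂ h₁ h₂ => simp only [smul_add, add_mul, h₁, h₂]
  | hmono k f =>
  induction G using induction with
  | h0 => simp
  | hadd F₁ F₂ h₁ h₂ => simp only [smul_add, mul_add, h₁, h₂]
  | hmono l g =>
  rw [← map_smul, mono_mul_mono, mono_mul_mono, ← map_smul, mul_smul_comm]

instance : Algebra ℂ (SAssoc q) := Algebra.ofModule SAssoc.smul_mul SAssoc.mul_smul

/-- The Lie algebra `𝒮_q`: the same space with the commutator bracket. -/
instance : LieRing (SAssoc q) := LieRing.ofAssociativeRing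

instance : LieAlgebra ℂ (SAssoc q) where
  lie_smul c F G := by
    rw [LieRing.of_associative_ring_bracket, LieRing.of_associative_ring_bracket,
      SAssoc.mul_smul, SAssoc.smul_mul, smul_sub]

theorem lie_def (F G : SAssoc q) : ⁅F, G⁆ = F * G - G * F := rfl

/-! ### The cocycle -/

/-- The trace form `tr₀ (∑ cⱼ wʲ) = c₀` on `ℂ[w, w⁻¹]`. -/
def trZero (f : ℂ[T;T⁻¹]) : ℂ := f.coeff 0

/-- The cocycle `Ψ`, determined by `Ψ(zᵐ f(w), zᵏ g(w)) = m δ_{m,-k} tr₀ (f(q⁻ᵐ w) g(w))`. -/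
def Psi (F G : SAssoc q) : ℂ :=
  F.coeffs.sum fun m f => (m : ℂ) * trZero (dilate (q ^ (-m)) f * coef (-m) G)

theorem Psi_mono_mono (m k : ℤ) (f g : ℂ[T;T⁻¹]) :
    Psi (mono q m f) (mono q k g) =
      if m = -k then (m : ℂ) * trZero (dilate (q ^ (-m)) f * g) else 0 := by
  rw [Psi, coeffs_mono, Finsupp.sum_single_index (by simp [trZero]), coef_mono]
  by_cases h : m = -k
  · subst h; simp
  · have : k ≠ -m := fun h' => h (by omega)
    simp [h, this, trZero]

theorem Psi_add_left (F G H : SAssoc q) : Psi (F + G) H = Psi F H + Psi G H := by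
  rw [Psi, coeffs_add]
  apply Finsupp.sum_add_index'
  · intro k; simp [trZero]
  · intro k f g; simp [trZero, add_mul, mul_add]

theorem Psi_add_right (F G H : SAssoc q) : Psi F (G + H) = Psi F G + Psi F H := by
  unfold Psi
  rw [← Finsupp.sum_add]
  refine Finsupp.sum_congr fun k _ => ?_
  simp [trZero, mul_add]

theorem Psi_zero_left (F : SAssoc q) : Psi 0 F = 0 := Finsupp.sum_zero_index

theorem Psi_zero_right (F : SAssoc q) : Psi F 0 = 0 := by
  have := Psi_add_right F 0 0
  simpa using this

theorem Psi_smul_right (c : ℂ) (F G : SAssoc q) : Psi F (c • G) = c * Psi F G := by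
  unfold Psi
  rw [Finsupp.mul_sum]
  refine Finsupp.sum_congr fun k _ => ?_
  simp [trZero]
  ring

theorem Psi_sub_left (F G H : SAssoc q) : Psi (F - G) H = Psi F H - Psi G H := by
  rw [eq_sub_iff_add_eq, ← Psi_add_left, sub_add_cancel]

theorem Psi_sub_right (F G H : SAssoc q) : Psi F (G - H) = Psi F G - Psi F H := by
  rw [eq_sub_iff_add_eq, ← Psi_add_right, sub_add_cancel]

theorem trZero_dilate (a : ℂˣ) (f : ℂ[T;T⁻¹]) : trZero (dilate a f) = trZero f := by
  simp [trZero, dilate_coeff]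

theorem Psi_skew (F G : SAssoc q) : Psi F G = -Psi G F := by
  induction F using induction with
  | h0 => simp [Psi_zero_left, Psi_zero_right]
  | hadd F₁ F₂ h₁ h₂ => rw [Psi_add_left, Psi_add_right, h₁, h₂]; ring
  | hmono k f =>
  induction G using induction with
  | h0 => simp [Psi_zero_left, Psi_zero_right]
  | hadd F₁ F₂ h₁ h₂ => rw [Psi_add_left, Psi_add_right, h₁, h₂]; ring
  | hmono l g =>
  rw [Psi_mono_mono, Psi_mono_mono]
  by_cases h : k = -l
  · subst h
    have := trZero_dilate (q ^ (-l)) (dilate (q ^ (- -l)) f * g)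
    rw [map_mul, dilate_dilate, ← zpow_add] at this
    simp only [neg_neg, neg_add_cancel, zpow_zero, dilate_one] at this
    simp only [neg_neg, if_true, ← this, mul_comm f]
    push_cast; ring
  · have : l ≠ -k := fun h' => h (by omega)
    simp [h, this]

theorem Psi_self (F : SAssoc q) : Psi F F = 0 := by
  have := Psi_skew F F
  linear_combination this / 2

theorem trZero_cyclic (k l : ℤ) (f g h : ℂ[T;T⁻¹]) :
    trZero (dilate (q ^ (-(-(k + l) + k))) (dilate (q ^ k) h * f) * g) =
      trZero (dilate (q ^ (-(k + l))) (dilate (q ^ l) f * g) * h) := by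
  rw [← trZero_dilate (q ^ (-(k + l)))]
  simp only [map_mul, dilate_dilate, ← zpow_add]
  rw [show -(k + l) + (-(-(k + l) + k) + k) = 0 by omega,
    show -(k + l) + -(-(k + l) + k) = -k by omega, show -(k + l) + l = -k by omega,
    zpow_zero, dilate_one, mul_comm _ h, mul_assoc]

theorem trZero_cyclic' (k l : ℤ) (f g h : ℂ[T;T⁻¹]) :
    trZero (dilate (q ^ (-(l + -(k + l)))) (dilate (q ^ (-(k + l))) g * h) * f) =
      trZero (dilate (q ^ (-(k + l))) (dilate (q ^ l) f * g) * h) := by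
  rw [← trZero_dilate (q ^ (-k))]
  simp only [map_mul, dilate_dilate, ← zpow_add]
  rw [show -k + (-(l + -(k + l)) + -(k + l)) = -(k + l) by omega,
    show -k + -(l + -(k + l)) = 0 by omega, show -(k + l) + l = -k by omega,
    zpow_zero, dilate_one, mul_comm _ (dilate (q ^ (-k)) f), mul_assoc]

/-- Associative form of the cocycle identity: `Ψ` is a cyclic cocycle. -/
theorem Psi_cyclic (F G H : SAssoc q) :
    Psi (F * G) H + Psi (G * H) F + Psi (H * F) G = 0 := by
  induction F using induction with
  | h0 => simp [Psi_zero_left, Psi_zero_right]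
  | hadd F₁ F₂ h₁ h₂ =>
    simp only [add_mul, mul_add, Psi_add_left, Psi_add_right]
    linear_combination h₁ + h₂
  | hmono k f =>
  induction G using induction with
  | h0 => simp [Psi_zero_left, Psi_zero_right]
  | hadd F₁ F₂ h₁ h₂ =>
    simp only [add_mul, mul_add, Psi_add_left, Psi_add_right]
    linear_combination h₁ + h₂
  | hmono l g =>
  induction H using induction with
  | h0 => simp [Psi_zero_left, Psi_zero_right]
  | hadd F₁ F₂ h₁ h₂ =>
    simp only [add_mul, mul_add, Psi_add_left, Psi_add_right]
    linear_combination h₁ + h₂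
  | hmono m h =>
  simp only [mono_mul_mono, Psi_mono_mono]
  by_cases hs : k + l + m = 0
  · have hm : m = -(k + l) := by omega
    subst hm
    rw [if_pos (by omega), if_pos (by omega), if_pos (by omega)]
    rw [trZero_cyclic, trZero_cyclic']
    push_cast; ring
  · rw [if_neg (by omega), if_neg (by omega), if_neg (by omega)]
    ring

theorem Psi_jacobi (F G H : SAssoc q) : Psi F ⁅G, H⁆ = Psi ⁅F, G⁆ H + Psi G ⁅F, H⁆ := by
  have e1 := Psi_cyclic F G H
  have e2 := Psi_cyclic G F H
  rw [Psi_skew F, Psi_skew G]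
  simp only [lie_def, Psi_sub_left]
  linear_combination e2 - e1

end SAssoc

/-- The derived algebra `𝒮'_q = [𝒮_q, 𝒮_q]`. -/
def derived (q : ℂˣ) : LieIdeal ℂ (SAssoc q) :=
  ⁅(⊤ : LieIdeal ℂ (SAssoc q)), (⊤ : LieIdeal ℂ (SAssoc q))⁆

theorem lie_mem_derived {q : ℂˣ} (F G : SAssoc q) : ⁅F, G⁆ ∈ derived q :=
  LieSubmodule.lie_mem_lie (LieSubmodule.mem_top F) (LieSubmodule.mem_top G)

/-- If `q` is not a root of unity, then `zᵏ f(T_q) ∈ 𝒮'_q` for `k ≠ 0`. -/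
theorem mono_mem_derived {q : ℂˣ} (hq : ∀ n : ℤ, n ≠ 0 → q ^ n ≠ 1) {k : ℤ} (hk : k ≠ 0)
    (f : ℂ[T;T⁻¹]) : SAssoc.mono q k f ∈ derived q := by
  have hc : ((q ^ k : ℂˣ) : ℂ) - 1 ≠ 0 := fun h => hq k hk (Units.ext (sub_eq_zero.mp h))
  have hT : dilate (q ^ k) (LaurentPolynomial.T 1) =
      ((q ^ k : ℂˣ) : ℂ) • LaurentPolynomial.T 1 := by
    ext n
    rw [dilate_coeff, AddMonoidAlgebra.coeff_smul, Finsupp.smul_apply, LaurentPolynomial.T_apply]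
    by_cases h : 1 = n
    · subst h; simp
    · simp [h]
  have h1 : (LaurentPolynomial.T 1 : ℂ[T;T⁻¹]) * (LaurentPolynomial.T (-1) * f) = f := by
    rw [← mul_assoc, ← LaurentPolynomial.T_add, add_neg_cancel, LaurentPolynomial.T_zero, one_mul]
  have key : ⁅SAssoc.mono q 0 (LaurentPolynomial.T 1),
      SAssoc.mono q k (LaurentPolynomial.T (-1) * f)⁆ =
      (((q ^ k : ℂˣ) : ℂ) - 1) • SAssoc.mono q k f := by
    rw [SAssoc.lie_def, SAssoc.mono_mul_mono, SAssoc.mono_mul_mono, zero_add, add_zero, hT,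
      zpow_zero, dilate_one, smul_mul_assoc, h1, mul_comm _ (LaurentPolynomial.T 1), h1,
      map_smul, sub_smul, one_smul]
  have := (derived q).smul_mem (((q ^ k : ℂˣ) : ℂ) - 1)⁻¹ (key ▸ lie_mem_derived _ _)
  rwa [smul_smul, inv_mul_cancel₀ hc, one_smul] at this

/-- If `q` is not a root of unity, then `T_qⁿ ∈ 𝒮'_q` for `n ≠ 0`. -/
theorem T_mem_derived {q : ℂˣ} (hq : ∀ n : ℤ, n ≠ 0 → q ^ n ≠ 1) {n : ℤ} (hn : n ≠ 0) :
    SAssoc.mono q 0 (LaurentPolynomial.T n) ∈ derived q := by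
  have hc : 1 - ((q ^ n : ℂˣ) : ℂ) ≠ 0 := fun h => hq n hn (Units.ext (sub_eq_zero.mp h).symm)
  have hT : dilate (q ^ (1 : ℤ)) (LaurentPolynomial.T n) =
      ((q ^ n : ℂˣ) : ℂ) • LaurentPolynomial.T n := by
    ext m
    rw [dilate_coeff, AddMonoidAlgebra.coeff_smul, Finsupp.smul_apply, LaurentPolynomial.T_apply]
    by_cases h : n = m
    · subst h; simp
    · simp [h]
  have key : ⁅SAssoc.mono q 1 1, SAssoc.mono q (-1) (LaurentPolynomial.T n)⁆ =
      (1 - ((q ^ n : ℂˣ) : ℂ)) • SAssoc.mono q 0 (LaurentPolynomial.T n) := by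
    rw [SAssoc.lie_def, SAssoc.mono_mul_mono, SAssoc.mono_mul_mono, hT, map_one, one_mul, mul_one,
      add_neg_cancel, neg_add_cancel, map_smul, sub_smul, one_smul]
  have := (derived q).smul_mem (1 - ((q ^ n : ℂˣ) : ℂ))⁻¹ (key ▸ lie_mem_derived _ _)
  rwa [smul_smul, inv_mul_cancel₀ hc, one_smul] at this

/-- The central extension `Ŝ_q = 𝒮'_q + ℂ C` defined by the cocycle `Ψ`. -/
@[ext]
structure SHat (q : ℂˣ) where
  /-- The component in `𝒮'_q`. -/
  op : derived q
  /-- The coefficient of the central element `C`. -/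
  central : ℂ

namespace SHat

variable {q : ℂˣ}

/-- The bijection of the underlying set with `𝒮'_q × ℂ`. -/
def equivProd : SHat q ≃ derived q × ℂ where
  toFun x := (x.op, x.central)
  invFun p := ⟨p.1, p.2⟩

instance : AddCommGroup (SHat q) := equivProd.addCommGroup
instance : Module ℂ (SHat q) := equivProd.module ℂ

@[simp] theorem op_add (x y : SHat q) : (x + y).op = x.op + y.op := rfl
@[simp] theorem op_zero : (0 : SHat q).op = 0 := rfl
@[simp] theorem op_smul (c : ℂ) (x : SHat q) : (c • x).op = c • x.op := rfl
@[simp] theorem central_add (x y : SHat q) : (x + y).central = x.central + y.central := rfl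
@[simp] theorem central_zero : (0 : SHat q).central = 0 := rfl
@[simp] theorem central_smul (c : ℂ) (x : SHat q) : (c • x).central = c * x.central := rfl

/-- The bracket `[f, g] = (f g - g f) + Ψ(f, g) C`, with `C` central. -/
instance : Bracket (SHat q) (SHat q) where
  bracket x y := ⟨⁅x.op, y.op⁆, SAssoc.Psi (x.op : SAssoc q) (y.op : SAssoc q)⟩

@[simp] theorem op_lie (x y : SHat q) : ⁅x, y⁆.op = ⁅x.op, y.op⁆ := rfl
@[simp] theorem central_lie (x y : SHat q) :
    ⁅x, y⁆.central = SAssoc.Psi (x.op : SAssoc q) (y.op : SAssoc q) := rfl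

instance : LieRing (SHat q) where
  add_lie x y z := by
    ext1
    · simp
    · simp [SAssoc.Psi_add_left]
  lie_add x y z := by
    ext1
    · simp
    · simp [SAssoc.Psi_add_right]
  lie_self x := by
    ext1
    · simp
    · simp [SAssoc.Psi_self]
  leibniz_lie x y z := by
    ext1
    · simp
    · exact SAssoc.Psi_jacobi _ _ _

instance : LieAlgebra ℂ (SHat q) where
  lie_smul c x y := by
    ext1
    · simp
    · simp [SAssoc.Psi_smul_right]

/-- The principal gradation: degree `j ≠ 0` is `{zʲ f(T_q)}`, and degree `0` is
`(𝒮'_q ∩ ℂ[T_q, T_q⁻¹]) + ℂ C`. -/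
def gradation (q : ℂˣ) (j : ℤ) : Submodule ℂ (SHat q) where
  carrier := {x | (∀ k, k ≠ j → SAssoc.coef k (x.op : SAssoc q) = 0) ∧ (j ≠ 0 → x.central = 0)}
  add_mem' := by
    rintro x y ⟨hx, hx'⟩ ⟨hy, hy'⟩
    refine ⟨fun k hk => ?_, fun hj => ?_⟩
    · simp [hx k hk, hy k hk]
    · simp [hx' hj, hy' hj]
  zero_mem' := ⟨fun k _ => by simp, fun _ => rfl⟩
  smul_mem' := by
    rintro c x ⟨hx, hx'⟩
    refine ⟨fun k hk => ?_, fun hj => ?_⟩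
    · simp [hx k hk]
    · simp [hx' hj]

/-- The element `zᵏ f(T_q)` of `Ŝ_q`, for `k ≠ 0`. -/
def zf (hq : ∀ n : ℤ, n ≠ 0 → q ^ n ≠ 1) (k : ℤ) (hk : k ≠ 0) (f : ℂ[T;T⁻¹]) : SHat q :=
  ⟨⟨SAssoc.mono q k f, mono_mem_derived hq hk f⟩, 0⟩

/-- The element `T_qⁿ` of `(Ŝ_q)₀`, for `n ≠ 0`. -/
def Tq (hq : ∀ n : ℤ, n ≠ 0 → q ^ n ≠ 1) (n : ℤ) (hn : n ≠ 0) : gradation q 0 :=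
  ⟨⟨⟨SAssoc.mono q 0 (LaurentPolynomial.T n), T_mem_derived hq hn⟩, 0⟩,
    fun k hk => by simp [SAssoc.coef_mono, hk.symm], fun h => absurd rfl h⟩

/-- The central element `C`. -/
def C (q : ℂˣ) : gradation q 0 :=
  ⟨⟨0, 1⟩, fun k _ => by simp, fun h => absurd rfl h⟩

end SHat

/-! ## Irreducible highest weight modules over a graded Lie algebra

A module over a Lie algebra `𝔤` is a module over its universal enveloping algebra `U(𝔤)`. -/

section HighestWeight

open UniversalEnvelopingAlgebra

variable {𝔤 : Type} [LieRing 𝔤] [LieAlgebra ℂ 𝔤] (𝒢 : ℤ → Submodule ℂ 𝔤)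

/-- The component of degree `j` of `U(𝔤)`: the span of the products `x₁ ⋯ xᵣ` of homogeneous
elements of `𝔤` whose degrees add up to `j`. -/
def envPiece (j : ℤ) : Submodule ℂ (UniversalEnvelopingAlgebra ℂ 𝔤) :=
  Submodule.span ℂ {u | ∃ l : List (ℤ × 𝔤), (∀ p ∈ l, p.2 ∈ 𝒢 p.1) ∧
    (l.map Prod.fst).sum = j ∧ u = (l.map fun p => ι ℂ p.2).prod}

variable {𝒢} (Λ : Module.Dual ℂ (𝒢 0))

/-- The left ideal of `U(𝔤)` generated by `𝔤₊` and by all `h - Λ(h)` with `h ∈ 𝔤₀`. -/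
def vermaIdeal : Submodule (UniversalEnvelopingAlgebra ℂ 𝔤) (UniversalEnvelopingAlgebra ℂ 𝔤) :=
  Submodule.span (UniversalEnvelopingAlgebra ℂ 𝔤)
    ({u | ∃ j : ℤ, 0 < j ∧ ∃ x ∈ 𝒢 j, u = ι ℂ x} ∪
      {u | ∃ h : 𝒢 0, u = ι ℂ (h : 𝔤) - algebraMap ℂ (UniversalEnvelopingAlgebra ℂ 𝔤) (Λ h)})

/-- The Verma module `M(Λ) = U(𝔤) ⊗_{U(𝔤₀ + 𝔤₊)} ℂ_Λ`, presented as the quotient of `U(𝔤)` by the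
left ideal generated by the annihilator of `ℂ_Λ` in `U(𝔤₀ + 𝔤₊)`. -/
abbrev Verma : Type := UniversalEnvelopingAlgebra ℂ 𝔤 ⧸ vermaIdeal Λ

/-- The component `M(Λ)ⱼ = U(𝔤)ⱼ v_Λ` of the Verma module. -/
def vermaPiece (j : ℤ) : Submodule ℂ (Verma Λ) :=
  (envPiece 𝒢 j).map ((vermaIdeal Λ).mkQ.restrictScalars ℂ)

/-- A submodule is graded if each of its elements is a sum of homogeneous elements of it. -/
def IsGradedSubmodule (N : Submodule (UniversalEnvelopingAlgebra ℂ 𝔤) (Verma Λ)) : Prop :=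
  N.restrictScalars ℂ ≤ ⨆ j : ℤ, N.restrictScalars ℂ ⊓ vermaPiece Λ j

/-- The maximal graded submodule of `M(Λ)`: the sum of all proper graded submodules. -/
def maxGraded : Submodule (UniversalEnvelopingAlgebra ℂ 𝔤) (Verma Λ) :=
  sSup {N | IsGradedSubmodule Λ N ∧ N ≠ ⊤}

/-- The irreducible highest weight module `L(Λ)`. -/
abbrev Irr : Type := Verma Λ ⧸ maxGraded Λ

/-- The highest weight vector `v_Λ` of `L(Λ)`. -/
def hwVector : Irr Λ := (maxGraded Λ).mkQ ((vermaIdeal Λ).mkQ 1)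

/-- The component `L(Λ)ⱼ`. -/
def irrPiece (j : ℤ) : Submodule ℂ (Irr Λ) :=
  (vermaPiece Λ j).map ((maxGraded Λ).mkQ.restrictScalars ℂ)

/-- `L(Λ)` is quasifinite if all its graded components are finite-dimensional. -/
def IsQuasifinite : Prop := ∀ j : ℤ, FiniteDimensional ℂ (irrPiece Λ j)

end HighestWeight

/-! ## Labels, generating series, characteristic polynomial -/

section Labels

variable {q : ℂˣ} (hq : ∀ n : ℤ, n ≠ 0 → q ^ n ≠ 1) (Λ : Module.Dual ℂ (SHat.gradation q 0))

/-- The label `Δₙ = Λ(T_qⁿ)`, for `n ≠ 0`. -/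
def label (n : ℤ) (hn : n ≠ 0) : ℂ := Λ (SHat.Tq hq n hn)

/-- The central charge `c = Λ(C)`. -/
def centralCharge : ℂ := Λ (SHat.C q)

/-- The formal series `Δ_Λ(x) = ∑_{n ≠ 0} Δₙ x⁻ⁿ`. A formal series `∑ₘ aₘ xᵐ`, infinite in both
directions, is encoded by the function `m ↦ aₘ`. -/
def genSeries : ℤ → ℂ :=
  fun m => if hm : m = 0 then 0 else label hq Λ (-m) (neg_ne_zero.mpr hm)

/-- The series `a(r x)`. -/
def substSeries (r : ℂˣ) (a : ℤ → ℂ) : ℤ → ℂ := fun m => ((r ^ m : ℂˣ) : ℂ) * a m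

/-- The constant series `c`. -/
def constSeries (c : ℂ) : ℤ → ℂ := Pi.single 0 c

/-- The product `b(x) a(x)` of a polynomial and a formal series. -/
def polyMulSeries (b : ℂ[X]) (a : ℤ → ℂ) : ℤ → ℂ :=
  fun m => b.sum fun j bj => bj * a (m - j)

/-- The equation `b(x) (Δ_Λ(x) - Δ_Λ(q⁻¹ x) + c) = 0`. -/
def SatisfiesEquation (b : ℂ[X]) : Prop :=
  polyMulSeries b
    (genSeries hq Λ - substSeries q⁻¹ (genSeries hq Λ) + constSeries (centralCharge Λ)) = 0

/-- A quasipolynomial: a linear combination of functions `p(x) e^{α x}`, `p` a polynomial. -/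
def IsQuasipolynomial (P : ℂ → ℂ) : Prop :=
  P ∈ Submodule.span ℂ
    {f : ℂ → ℂ | ∃ (p : ℂ[X]) (α : ℂ), f = fun x => p.eval x * Complex.exp (α * x)}

/-- `b` is monic, has the property `Q`, and has the least degree among monic polynomials with the
property `Q`. -/
def IsMinimalMonic (Q : ℂ[X] → Prop) (b : ℂ[X]) : Prop :=
  b.Monic ∧ Q b ∧ ∀ b' : ℂ[X], b'.Monic → Q b' → b.natDegree ≤ b'.natDegree

/-- `(z⁻¹ b(T_q)) v_Λ = 0` in `L(Λ)`. -/
def KillsHighestWeightVector (b : ℂ[X]) : Prop :=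
  UniversalEnvelopingAlgebra.ι ℂ (SHat.zf hq (-1) (by decide) (Polynomial.toLaurent b)) •
    hwVector Λ = 0

/-- `b` is a characteristic polynomial of `L(Λ)`: a monic polynomial of minimal degree with
`(z⁻¹ b(T_q)) v_Λ = 0`. -/
def IsCharacteristicPolynomial (b : ℂ[X]) : Prop :=
  IsMinimalMonic (KillsHighestWeightVector hq Λ) b

end Labels

end QPDO

end

open QPDO

noncomputable section

namespace QPDO

/-! ## Linear recurrences and quasipolynomials -/

section Recurrence

open Polynomial

/-! Put a(n) = (1 - qⁿ)Δₙ for n ≠ 0 and a(0) = c (`labelSeq`). Coefficient by coefficient, (∗) says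
that b annihilates a when x acts as the shift of two-sided sequences. The sequences annihilated by a
nonzero polynomial in the shift are exactly the restrictions to ℤ of quasipolynomials
(`exists_quasipolynomial_of_recurrence`, `IsQuasipolynomial.exists_recurrence`), so (i) and (ii) are
equivalent.

The link with the module is that [z T_qᵐ, z⁻¹ T_qʲ] acts on v_λ by q⁻ᵐ a(m + j), the cocycle
supplying exactly the value a(0) = c. In L(λ) a vector x v_λ with x of degree -1 vanishes if and
only if degree 1 kills it (`smul_hwVector_eq_zero_iff`). Hence (z⁻¹ b(T_q)) v_λ = 0 and (∗) are the
same condition on b (`killsHighestWeightVector_iff`). The polynomials satisfying it form a subspace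
of ℂ[x], in which a monic element of minimal degree is unique; this gives (b).

If L(λ)₋₁ is finite-dimensional, b ↦ (z⁻¹ b(T_q)) v_λ cannot be injective, so some b ≠ 0 kills v_λ.
Conversely, from one such b, brackets produce for each k < 0 a nonzero B with zᵏ B g killing v_λ for
all g. This property is inherited by all vectors obtained from v_λ by degree -1 operators. Since
those operators generate the lower components, each component is a finite sum of images of quotients
ℂ[w, w⁻¹]/(B), which are finite-dimensional.

The vanishing criterion requires v_λ ≠ 0, that is, that the Verma module does not collapse. Instead
of a PBW basis, the proof builds one highest weight module from the tensor algebra of the degree -1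
part (`exists_highestWeightModule`). Its augmentation gives a functional on the Verma module that is
1 on the highest weight vector and 0 below it; every proper graded submodule lies in the kernel. -/

/-- The shift `a(n) ↦ a(n + 1)` of two-sided sequences. -/
def shift : Module.End ℂ (ℤ → ℂ) := LinearMap.funLeft ℂ ℂ (· + 1)

theorem shift_apply (a : ℤ → ℂ) (n : ℤ) : shift a n = a (n + 1) := rfl

theorem shift_pow_apply (j : ℕ) (a : ℤ → ℂ) (n : ℤ) : (shift ^ j) a n = a (n + j) := by
  induction j generalizing n with
  | zero => simp
  | succ j ih =>
    rw [pow_succ', Module.End.mul_apply, shift_apply, ih]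
    congr 1; push_cast; ring

theorem aeval_shift_apply (b : ℂ[X]) (a : ℤ → ℂ) (n : ℤ) :
    aeval shift b a n = b.sum fun j bj => bj * a (n + j) := by
  rw [aeval_eq_sum_range, Polynomial.sum_over_range _ (by simp)]
  simp [LinearMap.sum_apply, Finset.sum_apply, shift_pow_apply]

/-- The operator p ↦ μ p(x + 1) - α p(x) is triangular in the degree, so surjectivity reduces to
hitting one polynomial with leading term a nonzero multiple of Xⁿ for each n. -/
theorem degreeLT_le_range_taylor_sub {μ α : ℂ} (hα : α ≠ 0) (n : ℕ) :
    degreeLT ℂ n ≤ LinearMap.range (μ • taylor (1 : ℂ) - α • (LinearMap.id : ℂ[X] →ₗ[ℂ] ℂ[X])) := by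
  induction n with
  | zero =>
    intro r hr
    rw [mem_degreeLT, degree_lt_iff_coeff_zero] at hr
    have : r = 0 := by ext k; simpa using hr k (Nat.zero_le _)
    rw [this]; exact zero_mem _
  | succ n ih =>
    have key : ∃ (p : ℂ[X]) (d : ℂ), d ≠ 0 ∧
        (μ • taylor 1 p - α • p) - d • X ^ n ∈ degreeLT ℂ n := by
      -- In the resonant case the leading terms cancel and the degree drops by one, so Xⁿ⁺¹ is used,
      -- with leading coefficient μ(n + 1). Only here is α ≠ 0 needed.
      by_cases h : μ = α
      · subst h
        refine ⟨X ^ (n + 1), μ * (n + 1), mul_ne_zero hα (Nat.cast_add_one_ne_zero n), ?_⟩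
        rw [mem_degreeLT, degree_lt_iff_coeff_zero]
        intro k hk
        have : taylor (1 : ℂ) (X ^ (n + 1)) = (X + 1) ^ (n + 1) := by
          simp [taylor_apply]
        simp only [this, coeff_sub, coeff_smul, coeff_X_add_one_pow, coeff_X_pow, smul_eq_mul]
        rcases hk.eq_or_lt with rfl | hk
        · simp
        · rcases (Nat.succ_le_of_lt hk).eq_or_lt with rfl | hk'
          · simp
          · rw [Nat.choose_eq_zero_of_lt hk', if_neg (by omega), if_neg (by omega)]; simp
      · refine ⟨X ^ n, μ - α, sub_ne_zero.mpr h, ?_⟩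
        rw [mem_degreeLT, degree_lt_iff_coeff_zero]
        intro k hk
        have : taylor (1 : ℂ) (X ^ n) = (X + 1) ^ n := by
          simp [taylor_apply]
        simp only [this, coeff_sub, coeff_smul, coeff_X_add_one_pow, coeff_X_pow, smul_eq_mul]
        rcases hk.eq_or_lt with rfl | hk
        · simp
        · rw [Nat.choose_eq_zero_of_lt hk, if_neg (by omega)]; simp
    obtain ⟨p, d, hd, hp⟩ := key
    intro r hr
    have h1 : r - (r.coeff n / d) • (μ • taylor 1 p - α • p) ∈ degreeLT ℂ n := by
      have h2 : r - r.coeff n • X ^ n ∈ degreeLT ℂ n := by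
        rw [mem_degreeLT, degree_lt_iff_coeff_zero] at hr ⊢
        intro k hk
        rcases hk.eq_or_lt with rfl | hk
        · simp
        · simp [hr k hk, coeff_X_pow, hk.ne']
      have h3 := sub_mem h2 (Submodule.smul_mem _ (r.coeff n / d) hp)
      convert h3 using 1
      rw [smul_sub _ _ (d • X ^ n), smul_smul _ d, div_mul_cancel₀ _ hd]
      abel
    obtain ⟨s, hs⟩ := ih h1
    refine ⟨s + (r.coeff n / d) • p, ?_⟩
    rw [map_add, hs, map_smul]
    simp

theorem exists_taylor_sub_eq (μ : ℂ) {α : ℂ} (hα : α ≠ 0) (r : ℂ[X]) :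
    ∃ p : ℂ[X], ∀ x, μ * p.eval (x + 1) - α * p.eval x = r.eval x := by
  obtain ⟨p, hp⟩ := degreeLT_le_range_taylor_sub (μ := μ) hα (r.natDegree + 1)
    (mem_degreeLT.mpr (by
      exact_mod_cast degree_le_natDegree.trans_lt (by exact_mod_cast Nat.lt_succ_self _)) :
      r ∈ degreeLT ℂ _)
  refine ⟨p, fun x => ?_⟩
  rw [← hp]
  simp [taylor_eval]

theorem isQuasipolynomial_exp (p : ℂ[X]) (α : ℂ) :
    IsQuasipolynomial fun x => p.eval x * Complex.exp (α * x) :=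
  Submodule.subset_span ⟨p, α, rfl⟩

theorem IsQuasipolynomial.translate {P : ℂ → ℂ} (hP : IsQuasipolynomial P) (t : ℂ) :
    IsQuasipolynomial fun x => P (x + t) := by
  induction hP using Submodule.span_induction with
  | mem f hf =>
    obtain ⟨p, α, rfl⟩ := hf
    convert isQuasipolynomial_exp (C (Complex.exp (α * t)) * p.comp (X + C t)) α using 2 with x
    simp only [eval_mul, eval_C, eval_comp, eval_add, eval_X, mul_add, Complex.exp_add]
    ring
  | zero => exact zero_mem _
  | add f g _ _ hf hg => exact add_mem hf hg
  | smul c f _ hf => exact Submodule.smul_mem _ c hf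

theorem IsQuasipolynomial.exists_sub_eq {Q : ℂ → ℂ} (hQ : IsQuasipolynomial Q) {α : ℂ}
    (hα : α ≠ 0) : ∃ P, IsQuasipolynomial P ∧ ∀ x, P (x + 1) - α * P x = Q x := by
  induction hQ using Submodule.span_induction with
  | mem f hf =>
    obtain ⟨r, γ, rfl⟩ := hf
    obtain ⟨p, hp⟩ := exists_taylor_sub_eq (Complex.exp γ) hα r
    refine ⟨_, isQuasipolynomial_exp p γ, fun x => ?_⟩
    simp only [mul_add, mul_one, Complex.exp_add, ← hp x]
    ring
  | zero => exact ⟨0, zero_mem _, fun x => by simp⟩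
  | add f g _ _ hf hg =>
    obtain ⟨P, hP, hP'⟩ := hf
    obtain ⟨R, hR, hR'⟩ := hg
    refine ⟨P + R, add_mem hP hR, fun x => ?_⟩
    simp only [Pi.add_apply, ← hP' x, ← hR' x]
    ring
  | smul c f _ hf =>
    obtain ⟨P, hP, hP'⟩ := hf
    refine ⟨c • P, Submodule.smul_mem _ c hP, fun x => ?_⟩
    simp only [Pi.smul_apply, smul_eq_mul, ← hP' x]
    ring

theorem eq_zpow_mul_of_shift_eq {α : ℂ} (hα : α ≠ 0) {d : ℤ → ℂ}
    (hd : ∀ n, d (n + 1) = α * d n) (n : ℤ) : d n = α ^ n * d 0 := by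
  induction n using Int.induction_on with
  | zero => simp
  | succ n ih => rw [hd, ih, zpow_add_one₀ hα]; ring
  | pred n ih =>
    have := hd (-n - 1)
    rw [sub_add_cancel, ih] at this
    rw [zpow_sub_one₀ hα]
    field_simp
    linear_combination -this

/-- Split off a root α of b. The sequence a(n + 1) - α a(n) is a quasipolynomial by induction on the
degree; a quasipolynomial solution of this first-order equation differs from a by a geometric
sequence. -/
theorem exists_quasipolynomial_of_recurrence {b : ℂ[X]} (hb : b ≠ 0) {a : ℤ → ℂ}
    (h : aeval shift b a = 0) : ∃ P, IsQuasipolynomial P ∧ ∀ n : ℤ, a n = P n := by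
  induction hn : b.natDegree generalizing b a with
  | zero =>
    obtain ⟨c, rfl⟩ := natDegree_eq_zero.mp hn
    have hc : c ≠ 0 := fun h => hb (by simp [h])
    rw [aeval_C, Module.algebraMap_end_apply, smul_eq_zero_iff_right hc] at h
    exact ⟨0, zero_mem _, fun n => by simp [h]⟩
  | succ k ih =>
    obtain ⟨α, hα⟩ := IsAlgClosed.exists_root b (by
      rw [degree_eq_natDegree hb, hn]; exact_mod_cast Nat.succ_ne_zero k)
    obtain ⟨b', rfl⟩ := dvd_iff_isRoot.mpr hα
    have hb' : b' ≠ 0 := right_ne_zero_of_mul hb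
    rw [natDegree_mul (X_sub_C_ne_zero α) hb', natDegree_X_sub_C] at hn
    rw [mul_comm, map_mul, Module.End.mul_apply] at h
    obtain ⟨Q, hQ, hQ'⟩ := ih hb' h (by omega)
    have hrec : ∀ n : ℤ, a (n + 1) - α * a n = Q n := fun n => by
      rw [← hQ']; simp [shift_apply]
    -- A zero root merely translates, a(n) = Q(n - 1), because the sequences are two-sided.
    by_cases hα0 : α = 0
    · refine ⟨_, hQ.translate (-1), fun n => ?_⟩
      have := hrec (n - 1)
      rw [hα0, zero_mul, sub_zero, sub_add_cancel] at this
      rw [this]; push_cast; ring_nf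
    · obtain ⟨P, hP, hP'⟩ := hQ.exists_sub_eq hα0
      have hd := eq_zpow_mul_of_shift_eq hα0 (d := fun n => a n - P n) (fun n => by
        have h1 := hrec n
        have h2 := hP' n
        push_cast
        linear_combination h1 - h2)
      refine ⟨P + fun x => (C (a 0 - P 0)).eval x * Complex.exp (Complex.log α * x),
        add_mem hP (isQuasipolynomial_exp _ _), fun n => ?_⟩
      have := hd n
      simp only [Int.cast_zero] at this
      simp only [Pi.add_apply, eval_C]
      rw [mul_comm (Complex.log α), Complex.exp_int_mul, Complex.exp_log hα0]
      linear_combination this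

/-- One factor, the shift minus e^α, replaces p(x) by e^α (p(x + 1) - p(x)), which lowers the
degree. -/
theorem aeval_shift_exp (α : ℂ) (k : ℕ) (p : ℂ[X]) (hp : p ∈ degreeLT ℂ k) :
    aeval shift ((X - C (Complex.exp α)) ^ k)
      (fun n : ℤ => p.eval (n : ℂ) * Complex.exp (α * n)) = 0 := by
  induction k generalizing p with
  | zero =>
    rw [mem_degreeLT, degree_lt_iff_coeff_zero] at hp
    have : p = 0 := by ext k; simpa using hp k (Nat.zero_le _)
    simp [this]; rfl
  | succ k ih =>
    rw [pow_succ, map_mul, Module.End.mul_apply]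
    have : aeval shift (X - C (Complex.exp α))
        (fun n : ℤ => p.eval (n : ℂ) * Complex.exp (α * n)) =
        fun n : ℤ => (Complex.exp α • (taylor 1 p - p)).eval (n : ℂ) * Complex.exp (α * n) := by
      funext n
      simp [shift_apply, taylor_eval, mul_add, Complex.exp_add]
      ring
    rw [this]
    apply ih
    refine Submodule.smul_mem _ _ ?_
    rw [mem_degreeLT, degree_lt_iff_coeff_zero] at hp ⊢
    intro m hm
    rw [coeff_sub]
    rcases hm.eq_or_lt with rfl | hm
    · have hdeg : p.natDegree ≤ k := natDegree_le_iff_coeff_eq_zero.mpr fun N hN => hp N hN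
      have : taylor 1 p = p + (taylor 1 p - p) := by ring
      rcases hdeg.eq_or_lt with rfl | hlt
      · rw [coeff_taylor_natDegree]; simp
      · rw [coeff_eq_zero_of_natDegree_lt hlt,
          coeff_eq_zero_of_natDegree_lt (by rwa [natDegree_taylor]), sub_zero]
    · rw [hp m hm, coeff_eq_zero_of_natDegree_lt, sub_zero]
      rw [natDegree_taylor]
      exact (natDegree_le_iff_coeff_eq_zero.mpr fun N hN => hp N hN).trans_lt hm

theorem IsQuasipolynomial.exists_recurrence {P : ℂ → ℂ} (hP : IsQuasipolynomial P) :
    ∃ b : ℂ[X], b ≠ 0 ∧ aeval shift b (fun n : ℤ => P n) = 0 := by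
  induction hP using Submodule.span_induction with
  | mem f hf =>
    obtain ⟨p, α, rfl⟩ := hf
    exact ⟨_, pow_ne_zero _ (X_sub_C_ne_zero _), aeval_shift_exp α (p.natDegree + 1) p
      (mem_degreeLT.mpr (by
        exact_mod_cast degree_le_natDegree.trans_lt (by exact_mod_cast Nat.lt_succ_self _)))⟩
  | zero => exact ⟨1, one_ne_zero, by simp; rfl⟩
  | add f g _ _ hf hg =>
    obtain ⟨b, hb, hb'⟩ := hf
    obtain ⟨c, hc, hc'⟩ := hg
    refine ⟨b * c, mul_ne_zero hb hc, ?_⟩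
    have : (fun n : ℤ => (f + g) (n : ℂ)) = (fun n : ℤ => f n) + fun n : ℤ => g n := rfl
    rw [this, map_add]
    nth_rewrite 1 [mul_comm]
    simp [Module.End.mul_apply, hb', hc']
  | smul c f _ hf =>
    obtain ⟨b, hb, hb'⟩ := hf
    refine ⟨b, hb, ?_⟩
    have : (fun n : ℤ => (c • f) (n : ℂ)) = c • fun n : ℤ => f n := rfl
    rw [this, map_smul, hb', smul_zero]

end Recurrence

/-! ## Triangular decompositions of generated Lie subalgebras -/

section Triangular

variable {𝔩 : Type*} [LieRing 𝔩] [LieAlgebra ℂ 𝔩] {P H Q : Submodule ℂ 𝔩}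

open LieSubalgebra

theorem lie_lieSpan_mem (hHP : ∀ h ∈ H, ∀ x ∈ P, ⁅h, x⁆ ∈ P) {h s : 𝔩} (hh : h ∈ H)
    (hs : s ∈ lieSpan ℂ 𝔩 (P : Set 𝔩)) : ⁅h, s⁆ ∈ lieSpan ℂ 𝔩 (P : Set 𝔩) := by
  induction hs using lieSpan_induction with
  | mem x hx => exact subset_lieSpan (hHP h hh x hx)
  | zero => rw [lie_zero]; exact zero_mem _
  | add x y _ _ hx hy => rw [lie_add]; exact add_mem hx hy
  | smul c x _ hx => rw [lie_smul]; exact LieSubalgebra.smul_mem _ c hx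
  | lie x y hx hy hx' hy' =>
    rw [leibniz_lie]
    exact add_mem (lie_mem _ hx' hy) (lie_mem _ hx hy')

/-- Bracketing with y is a derivation that sends generators into `H`, and `H` normalizes the
subalgebra generated by `P`. So every factor of an iterated bracket that y hits stays inside. -/
theorem lie_lieSpan_mem_sup (hHP : ∀ h ∈ H, ∀ x ∈ P, ⁅h, x⁆ ∈ P)
    (hQP : ∀ y ∈ Q, ∀ x ∈ P, ⁅y, x⁆ ∈ H) {y s : 𝔩} (hy : y ∈ Q)
    (hs : s ∈ lieSpan ℂ 𝔩 (P : Set 𝔩)) :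
    ⁅y, s⁆ ∈ (lieSpan ℂ 𝔩 (P : Set 𝔩)).toSubmodule ⊔ H := by
  have aux : ∀ {a b : 𝔩}, a ∈ (lieSpan ℂ 𝔩 (P : Set 𝔩)).toSubmodule ⊔ H →
      b ∈ lieSpan ℂ 𝔩 (P : Set 𝔩) → ⁅a, b⁆ ∈ lieSpan ℂ 𝔩 (P : Set 𝔩) := by
    intro a b ha hb
    obtain ⟨a₁, h₁, a₂, h₂, rfl⟩ := Submodule.mem_sup.mp ha
    rw [add_lie]
    exact add_mem (lie_mem _ h₁ hb) (lie_lieSpan_mem hHP h₂ hb)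
  induction hs using lieSpan_induction with
  | mem x hx => exact Submodule.mem_sup_right (hQP y hy x hx)
  | zero => rw [lie_zero]; exact zero_mem _
  | add x y _ _ hx hy => rw [lie_add]; exact add_mem hx hy
  | smul c x _ hx => rw [lie_smul]; exact Submodule.smul_mem _ c hx
  | lie a b ha hb ha' hb' =>
    rw [leibniz_lie]
    refine Submodule.mem_sup_left (add_mem (aux ha' hb) ?_)
    rw [← lie_skew]
    exact neg_mem (aux hb' ha)

theorem lieSpan_union_le (hHP : ∀ h ∈ H, ∀ x ∈ P, ⁅h, x⁆ ∈ P)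
    (hHQ : ∀ h ∈ H, ∀ x ∈ Q, ⁅h, x⁆ ∈ Q) (hHH : ∀ h ∈ H, ∀ x ∈ H, ⁅h, x⁆ ∈ H)
    (hQP : ∀ y ∈ Q, ∀ x ∈ P, ⁅y, x⁆ ∈ H) {s : 𝔩}
    (hs : s ∈ lieSpan ℂ 𝔩 ((P : Set 𝔩) ∪ H ∪ Q)) :
    s ∈ (lieSpan ℂ 𝔩 (P : Set 𝔩)).toSubmodule ⊔ H ⊔ (lieSpan ℂ 𝔩 (Q : Set 𝔩)).toSubmodule := by
  set A := (lieSpan ℂ 𝔩 (P : Set 𝔩)).toSubmodule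
  set B := (lieSpan ℂ 𝔩 (Q : Set 𝔩)).toSubmodule
  have hPQ : ∀ x ∈ P, ∀ y ∈ Q, ⁅x, y⁆ ∈ H := fun x hx y hy => by
    rw [← lie_skew]; exact neg_mem (hQP y hy x hx)
  have hA : ∀ {x}, x ∈ A → x ∈ A ⊔ H ⊔ B := fun h =>
    Submodule.mem_sup_left (Submodule.mem_sup_left h)
  have hH : ∀ {x}, x ∈ H → x ∈ A ⊔ H ⊔ B := fun h =>
    Submodule.mem_sup_left (Submodule.mem_sup_right h)
  have hB : ∀ {x}, x ∈ B → x ∈ A ⊔ H ⊔ B := fun h => Submodule.mem_sup_right h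
  have hBH : B ⊔ H ≤ A ⊔ H ⊔ B := sup_le le_sup_right (le_sup_right.trans le_sup_left)
  -- Membership alone does not survive the bracket step of the induction. The added claim that s
  -- stabilizes the sum does, by the Jacobi identity, and then only generators have to be checked.
  have main : s ∈ A ⊔ H ⊔ B ∧ ∀ t ∈ A ⊔ H ⊔ B, ⁅s, t⁆ ∈ A ⊔ H ⊔ B := by
    induction hs using lieSpan_induction with
    | mem x hx =>
      rcases hx with (hx | hx) | hx
      · refine ⟨hA (subset_lieSpan hx), fun t ht => ?_⟩
        obtain ⟨t', ht', b, hb, rfl⟩ := Submodule.mem_sup.mp ht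
        obtain ⟨a, ha, h, hh, rfl⟩ := Submodule.mem_sup.mp ht'
        rw [lie_add, lie_add]
        refine add_mem (add_mem (hA (lie_mem _ (subset_lieSpan hx) ha)) (hA ?_))
          (hBH (lie_lieSpan_mem_sup hHQ hPQ hx hb))
        rw [← lie_skew]
        exact neg_mem (subset_lieSpan (hHP h hh x hx))
      · refine ⟨hH hx, fun t ht => ?_⟩
        obtain ⟨t', ht', b, hb, rfl⟩ := Submodule.mem_sup.mp ht
        obtain ⟨a, ha, h, hh, rfl⟩ := Submodule.mem_sup.mp ht'
        rw [lie_add, lie_add]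
        exact add_mem (add_mem (hA (lie_lieSpan_mem hHP hx ha)) (hH (hHH x hx h hh)))
          (hB (lie_lieSpan_mem hHQ hx hb))
      · refine ⟨hB (subset_lieSpan hx), fun t ht => ?_⟩
        obtain ⟨t', ht', b, hb, rfl⟩ := Submodule.mem_sup.mp ht
        obtain ⟨a, ha, h, hh, rfl⟩ := Submodule.mem_sup.mp ht'
        rw [lie_add, lie_add]
        refine add_mem (add_mem (Submodule.mem_sup_left (lie_lieSpan_mem_sup hHP hQP hx ha))
          (hB ?_)) (hB (lie_mem _ (subset_lieSpan hx) hb))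
        rw [← lie_skew]
        exact neg_mem (subset_lieSpan (hHQ h hh x hx))
    | zero => exact ⟨zero_mem _, fun t _ => by rw [zero_lie]; exact zero_mem _⟩
    | add x y _ _ hx hy =>
      refine ⟨add_mem hx.1 hy.1, fun t ht => ?_⟩
      rw [add_lie]; exact add_mem (hx.2 t ht) (hy.2 t ht)
    | smul c x _ hx =>
      refine ⟨Submodule.smul_mem _ c hx.1, fun t ht => ?_⟩
      rw [smul_lie]; exact Submodule.smul_mem _ c (hx.2 t ht)
    | lie x y _ _ hx hy =>
      refine ⟨hx.2 y hy.1, fun t ht => ?_⟩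
      rw [lie_lie]
      exact sub_mem (hx.2 _ (hy.2 t ht)) (hy.2 _ (hx.2 t ht))
  exact main.1

end Triangular

/-! ## Graded Lie algebras generated by their local part -/

section LocallyGenerated

open UniversalEnvelopingAlgebra

variable {𝔤 : Type} [LieRing 𝔤] [LieAlgebra ℂ 𝔤]

/-- A `ℤ`-graded Lie algebra with abelian degree zero part whose positive and negative parts are
generated in degrees `1` and `-1`. -/
structure IsLocallyGenerated (𝒢 : ℤ → Submodule ℂ 𝔤) : Prop where
  lie_mem : ∀ {i j : ℤ} {x y : 𝔤}, x ∈ 𝒢 i → y ∈ 𝒢 j → ⁅x, y⁆ ∈ 𝒢 (i + j)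
  lie_eq_zero : ∀ {x y : 𝔤}, x ∈ 𝒢 0 → y ∈ 𝒢 0 → ⁅x, y⁆ = 0
  iSup_eq_top : ⨆ j, 𝒢 j = ⊤
  pos_le : ∀ k : ℤ, 0 < k →
    𝒢 (1 + k) ≤ Submodule.span ℂ {z | ∃ x ∈ 𝒢 1, ∃ y ∈ 𝒢 k, ⁅x, y⁆ = z}
  neg_le : ∀ k : ℤ, k < 0 →
    𝒢 (-1 + k) ≤ Submodule.span ℂ {z | ∃ x ∈ 𝒢 (-1), ∃ y ∈ 𝒢 k, ⁅x, y⁆ = z}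
  exists_proj : ∃ π : 𝔤 →ₗ[ℂ] 𝒢 0, (∀ h : 𝒢 0, π h = h) ∧ ∀ k ≠ 0, ∀ x ∈ 𝒢 k, π x = 0

variable {𝒢 : ℤ → Submodule ℂ 𝔤}

namespace IsLocallyGenerated

/-- Properties of homogeneous elements that are compatible with brackets need checking only in
degrees -1, 0 and 1. -/
theorem le_of_local (h𝒢 : IsLocallyGenerated 𝒢) {𝓟 : ℤ → Submodule ℂ 𝔤} (h0 : 𝒢 0 ≤ 𝓟 0)
    (h1 : 𝒢 1 ≤ 𝓟 1) (hm : 𝒢 (-1) ≤ 𝓟 (-1))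
    (hP : ∀ {i j : ℤ} {x y : 𝔤}, x ∈ 𝓟 i → y ∈ 𝓟 j → ⁅x, y⁆ ∈ 𝓟 (i + j)) (k : ℤ) :
    𝒢 k ≤ 𝓟 k := by
  have hpos : ∀ n : ℕ, 𝒢 (n + 1) ≤ 𝓟 (n + 1) := by
    intro n
    induction n with
    | zero => simpa using h1
    | succ n ih =>
      have := h𝒢.pos_le (n + 1) (by omega)
      rw [show ((n + 1 : ℕ) : ℤ) + 1 = 1 + (n + 1) by push_cast; ring]
      refine this.trans (Submodule.span_le.mpr ?_)
      rintro z ⟨x, hx, y, hy, rfl⟩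
      exact hP (h1 hx) (ih hy)
  have hneg : ∀ n : ℕ, 𝒢 (-(n + 1)) ≤ 𝓟 (-(n + 1)) := by
    intro n
    induction n with
    | zero => simpa using hm
    | succ n ih =>
      have := h𝒢.neg_le (-(n + 1)) (by omega)
      rw [show -(((n + 1 : ℕ) : ℤ) + 1) = -1 + -(n + 1) by push_cast; ring]
      refine this.trans (Submodule.span_le.mpr ?_)
      rintro z ⟨x, hx, y, hy, rfl⟩
      exact hP (hm hx) (ih hy)
  rcases lt_trichotomy k 0 with hk | rfl | hk
  · obtain ⟨n, rfl⟩ : ∃ n : ℕ, k = -(n + 1) := ⟨(-k - 1).toNat, by omega⟩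
    exact hneg n
  · exact h0
  · obtain ⟨n, rfl⟩ : ∃ n : ℕ, k = n + 1 := ⟨(k - 1).toNat, by omega⟩
    exact hpos n

end IsLocallyGenerated

/-! ### Descending from a space annihilated by the positive part -/

section Descend

attribute [local instance 100] LieRing.ofAssociativeRing

variable {M : Type*} [AddCommGroup M] [Module ℂ M] (ρ : 𝔤 →ₗ⁅ℂ⁆ Module.End ℂ M)

variable (𝒢) in
/-- The span of the vectors `x₁ ⋯ xₙ y` with `xᵢ` of degree `-1` and `y ∈ Y`. -/
def descend (Y : Submodule ℂ M) : ℕ → Submodule ℂ M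
  | 0 => Y
  | n + 1 => Submodule.span ℂ {m | ∃ x ∈ 𝒢 (-1), ∃ w ∈ descend Y n, ρ x w = m}

variable (𝒢) in
/-- The spaces `descend` as a family indexed by degrees, `Y` having degree `0`. -/
def descendPiece (Y : Submodule ℂ M) (j : ℤ) : Submodule ℂ M :=
  ⨆ (n : ℕ) (_ : -(n : ℤ) = j), descend 𝒢 ρ Y n

variable {Y : Submodule ℂ M}

theorem descend_le_descendPiece (n : ℕ) : descend 𝒢 ρ Y n ≤ descendPiece 𝒢 ρ Y (-n) :=
  le_iSup₂_of_le n rfl le_rfl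

theorem descendPiece_le_descend (n : ℕ) : descendPiece 𝒢 ρ Y (-n) ≤ descend 𝒢 ρ Y n :=
  iSup₂_le fun m hm => by rw [show m = n by omega]

theorem descendPiece_of_pos {j : ℤ} (hj : 0 < j) : descendPiece 𝒢 ρ Y j = ⊥ :=
  eq_bot_iff.mpr (iSup₂_le fun m hm => by omega)

theorem apply_mem_of_forall_descend {x : 𝔤} {k : ℤ}
    (h : ∀ n : ℕ, ∀ w ∈ descend 𝒢 ρ Y n, ρ x w ∈ descendPiece 𝒢 ρ Y (k - n)) {j : ℤ} {w : M}
    (hw : w ∈ descendPiece 𝒢 ρ Y j) : ρ x w ∈ descendPiece 𝒢 ρ Y (k + j) := by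
  have : descendPiece 𝒢 ρ Y j ≤ (descendPiece 𝒢 ρ Y (k + j)).comap (ρ x) := by
    refine iSup₂_le fun n hn w hw => ?_
    rw [← hn]
    exact h n w hw
  exact this hw

theorem neg_one_apply_mem {x : 𝔤} (hx : x ∈ 𝒢 (-1)) {j : ℤ} {w : M}
    (hw : w ∈ descendPiece 𝒢 ρ Y j) : ρ x w ∈ descendPiece 𝒢 ρ Y (-1 + j) := by
  refine apply_mem_of_forall_descend ρ (fun n w hw => ?_) hw
  rw [show -1 - (n : ℤ) = -((n + 1 : ℕ) : ℤ) by push_cast; ring]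
  exact descend_le_descendPiece ρ _ (Submodule.subset_span ⟨x, hx, w, hw, rfl⟩)

theorem map_lie_apply (x y : 𝔤) (w : M) : ρ x (ρ y w) = ρ ⁅x, y⁆ w + ρ y (ρ x w) := by
  rw [LieHom.map_lie, LieRing.of_associative_ring_bracket]
  simp

theorem zero_apply_mem (h𝒢 : IsLocallyGenerated 𝒢) (hY : ∀ h ∈ 𝒢 0, ∀ y ∈ Y, ρ h y ∈ Y)
    {x : 𝔤} (hx : x ∈ 𝒢 0) {j : ℤ} {w : M}
    (hw : w ∈ descendPiece 𝒢 ρ Y j) : ρ x w ∈ descendPiece 𝒢 ρ Y (0 + j) := by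
  refine apply_mem_of_forall_descend ρ (fun n w hw => ?_) hw
  rw [zero_sub]
  refine descend_le_descendPiece ρ _ ?_
  induction n generalizing w with
  | zero => exact hY x hx w hw
  | succ n ih =>
    induction hw using Submodule.span_induction with
    | mem w hw =>
      obtain ⟨f, hf, u, hu, rfl⟩ := hw
      rw [map_lie_apply]
      refine add_mem (Submodule.subset_span ⟨_, ?_, u, hu, rfl⟩)
        (Submodule.subset_span ⟨f, hf, _, ih u hu, rfl⟩)
      simpa using h𝒢.lie_mem hx hf
    | zero => rw [map_zero]; exact zero_mem _
    | add u v _ _ hu hv => rw [map_add]; exact add_mem hu hv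
    | smul c u _ hu => rw [map_smul]; exact Submodule.smul_mem _ c hu

theorem one_apply_mem (h𝒢 : IsLocallyGenerated 𝒢) (hY : ∀ h ∈ 𝒢 0, ∀ y ∈ Y, ρ h y ∈ Y)
    (hY' : ∀ e ∈ 𝒢 1, ∀ y ∈ Y, ρ e y = 0) {x : 𝔤} (hx : x ∈ 𝒢 1) {j : ℤ} {w : M}
    (hw : w ∈ descendPiece 𝒢 ρ Y j) : ρ x w ∈ descendPiece 𝒢 ρ Y (1 + j) := by
  refine apply_mem_of_forall_descend ρ (fun n w hw => ?_) hw
  induction n generalizing w with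
  | zero => rw [hY' x hx w hw]; exact zero_mem _
  | succ n ih =>
    have e : (1 : ℤ) - (n + 1 : ℕ) = -n := by push_cast; ring
    rw [e]
    induction hw using Submodule.span_induction with
    | mem w hw =>
      obtain ⟨f, hf, u, hu, rfl⟩ := hw
      rw [map_lie_apply]
      have h0 : ⁅x, f⁆ ∈ 𝒢 0 := by simpa using h𝒢.lie_mem hx hf
      have h1 := zero_apply_mem ρ h𝒢 hY h0 (descend_le_descendPiece ρ n hu)
      have h2 := neg_one_apply_mem ρ hf (ih u hu)
      rw [zero_add] at h1
      rw [show -1 + (1 - (n : ℤ)) = -n by ring] at h2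
      exact add_mem h1 h2
    | zero => rw [map_zero]; exact zero_mem _
    | add u v _ _ hu hv => rw [map_add]; exact add_mem hu hv
    | smul c u _ hu => rw [map_smul]; exact Submodule.smul_mem _ c hu

/-- This replaces PBW: when degree 1 kills `Y` and degree 0 preserves it, applying degree -1
elements alone already gives a graded space stable under 𝔤, with nothing in positive degrees. -/
theorem apply_mem_descendPiece (h𝒢 : IsLocallyGenerated 𝒢)
    (hY : ∀ h ∈ 𝒢 0, ∀ y ∈ Y, ρ h y ∈ Y) (hY' : ∀ e ∈ 𝒢 1, ∀ y ∈ Y, ρ e y = 0) {k : ℤ} {x : 𝔤}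
    (hx : x ∈ 𝒢 k) {j : ℤ} {w : M} (hw : w ∈ descendPiece 𝒢 ρ Y j) :
    ρ x w ∈ descendPiece 𝒢 ρ Y (k + j) := by
  -- The elements of 𝔤 that shift degrees by k form a family closed under brackets, so the local
  -- part suffices.
  let 𝓟 : ℤ → Submodule ℂ 𝔤 := fun k =>
    { carrier := {x | ∀ (j : ℤ) (w : M), w ∈ descendPiece 𝒢 ρ Y j →
        ρ x w ∈ descendPiece 𝒢 ρ Y (k + j)}
      add_mem' := fun hx hy j w hw => by
        rw [map_add]; exact add_mem (hx j w hw) (hy j w hw)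
      zero_mem' := fun j w _ => by rw [map_zero]; exact zero_mem _
      smul_mem' := fun c x hx j w hw => by
        rw [map_smul]; exact Submodule.smul_mem _ c (hx j w hw) }
  refine h𝒢.le_of_local (𝓟 := 𝓟) (fun x hx j w hw => zero_apply_mem ρ h𝒢 hY hx hw)
    (fun x hx j w hw => one_apply_mem ρ h𝒢 hY hY' hx hw)
    (fun x hx j w hw => neg_one_apply_mem ρ hx hw) ?_ k hx j w hw
  intro i j x y hx hy l w hw
  rw [show ρ ⁅x, y⁆ w = ρ x (ρ y w) - ρ y (ρ x w) by rw [map_lie_apply]; abel]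
  refine sub_mem ?_ ?_
  · rw [add_assoc]; exact hx _ _ (hy _ _ hw)
  · rw [add_comm i, add_assoc]; exact hy _ _ (hx _ _ hw)

end Descend

/-! ### Modules over the enveloping algebra -/

section Env

attribute [local instance 100] LieRing.ofAssociativeRing

variable {M : Type*} [AddCommGroup M] [Module ℂ M] [Module (UniversalEnvelopingAlgebra ℂ 𝔤) M]
  [IsScalarTower ℂ (UniversalEnvelopingAlgebra ℂ 𝔤) M]

variable (M) in
/-- The action of `𝔤` on a module over its enveloping algebra. -/
def envRep : 𝔤 →ₗ⁅ℂ⁆ Module.End ℂ M :=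
  (Algebra.lsmul ℂ ℂ M : UniversalEnvelopingAlgebra ℂ 𝔤 →ₐ[ℂ] Module.End ℂ M).toLieHom.comp (ι ℂ)

theorem envRep_apply (x : 𝔤) (m : M) : envRep M x m = ι ℂ x • m := rfl

theorem smul_mem_descendPiece (h𝒢 : IsLocallyGenerated 𝒢) {Y : Submodule ℂ M}
    (hY : ∀ h ∈ 𝒢 0, ∀ y ∈ Y, ι ℂ h • y ∈ Y) (hY' : ∀ e ∈ 𝒢 1, ∀ y ∈ Y, ι ℂ e • y = 0) {k : ℤ}
    {u : UniversalEnvelopingAlgebra ℂ 𝔤} (hu : u ∈ envPiece 𝒢 k) {j : ℤ} {w : M}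
    (hw : w ∈ descendPiece 𝒢 (envRep M) Y j) :
    u • w ∈ descendPiece 𝒢 (envRep M) Y (k + j) := by
  induction hu using Submodule.span_induction with
  | mem u hu =>
    obtain ⟨l, hl, rfl, rfl⟩ := hu
    induction l with
    | nil => simpa using hw
    | cons p l ih =>
      rw [List.map_cons, List.map_cons, List.prod_cons, List.sum_cons, mul_smul, add_assoc]
      exact apply_mem_descendPiece (envRep M) h𝒢 hY hY' (hl p (by simp))
        (ih fun p hp => hl p (by simp [hp]))
  | zero => rw [zero_smul]; exact zero_mem _
  | add u v _ _ hu hv => rw [add_smul]; exact add_mem hu hv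
  | smul c u _ hu => rw [smul_assoc]; exact Submodule.smul_mem _ c hu

end Env

end LocallyGenerated

/-! ## Existence of highest weight modules

The tensor algebra of the degree `-1` part carries an action of the local part of `𝔤`; the graph of
the action it generates is a Lie subalgebra of `𝔤 × End T`, and dividing by the image of its vertical
part yields a highest weight module over `𝔤`. -/

section Existence

open UniversalEnvelopingAlgebra

attribute [local instance 100] LieRing.ofAssociativeRing

/-! ### Recursion on the leftmost factor in a tensor algebra -/

section TensorRecursion

variable {V : Type*} [AddCommGroup V] [Module ℂ V]

@[elab_as_elim]
theorem tensorAlgebra_induction_left {p : TensorAlgebra ℂ V → Prop} (one : p 1)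
    (add : ∀ t u, p t → p u → p (t + u)) (smul : ∀ (c : ℂ) t, p t → p (c • t))
    (mul : ∀ v t, p t → p (TensorAlgebra.ι ℂ v * t)) (t : TensorAlgebra ℂ V) : p t := by
  have : ∀ u, p u → p (t * u) := by
    induction t using TensorAlgebra.induction with
    | algebraMap r => intro u hu; rw [← Algebra.smul_def]; exact smul r u hu
    | ι v => exact fun u hu => mul v u hu
    | mul a b ha hb => intro u hu; rw [mul_assoc]; exact ha _ (hb u hu)
    | add a b ha hb => intro u hu; rw [add_mul]; exact add _ _ (ha u hu) (hb u hu)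
  simpa using this 1 one

/-- Linear endomorphisms of the tensor algebra defined by recursion on the leftmost factor. -/
theorem exists_tensorAlgebra_rec (θ : V →ₗ[ℂ] Module.End ℂ (TensorAlgebra ℂ V))
    (c : TensorAlgebra ℂ V) : ∃ y : Module.End ℂ (TensorAlgebra ℂ V), y 1 = c ∧
      ∀ v t, y (TensorAlgebra.ι ℂ v * t) = θ v t + TensorAlgebra.ι ℂ v * y t := by
  let T := TensorAlgebra ℂ V
  let L : V →ₗ[ℂ] Module.End ℂ T := (Algebra.lmul ℂ T).toLinearMap ∘ₗ TensorAlgebra.ι ℂ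
  -- Primitive recursion through the universal property: in the orbit of (c, 1) the second
  -- coordinate reproduces t and the first accumulates y t.
  let Φ : V →ₗ[ℂ] Module.End ℂ (T × T) :=
    { toFun := fun v => LinearMap.prod (L v ∘ₗ LinearMap.fst ℂ T T + θ v ∘ₗ LinearMap.snd ℂ T T)
        (L v ∘ₗ LinearMap.snd ℂ T T)
      map_add' := fun v w => by
        ext <;> simp
      map_smul' := fun a v => by
        ext <;> simp }
  let F := TensorAlgebra.lift ℂ Φ
  have h2 : ∀ t : T, (F t (c, 1)).2 = t := fun t => by
    induction t using tensorAlgebra_induction_left with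
    | one => simp
    | add t u ht hu => rw [map_add, LinearMap.add_apply, Prod.snd_add, ht, hu]
    | smul a t ht => rw [map_smul, LinearMap.smul_apply, Prod.smul_snd, ht]
    | mul v t ht =>
      rw [map_mul, Module.End.mul_apply,
        show F (TensorAlgebra.ι ℂ v) = Φ v from TensorAlgebra.lift_ι_apply Φ v]
      change L v (F t (c, 1)).2 = _
      rw [ht]
      rfl
  refine ⟨LinearMap.fst ℂ T T ∘ₗ LinearMap.applyₗ (c, (1 : T)) ∘ₗ F.toLinearMap, ?_,
    fun v t => ?_⟩
  · simp
  · have := h2 t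
    simp only [LinearMap.comp_apply, AlgHom.toLinearMap_apply, LinearMap.applyₗ_apply_apply,
      LinearMap.fst_apply, map_mul, Module.End.mul_apply]
    rw [show F (TensorAlgebra.ι ℂ v) = Φ v from TensorAlgebra.lift_ι_apply Φ v]
    change L v (F t (c, 1)).1 + θ v (F t (c, 1)).2 = _
    rw [this, add_comm]
    rfl

end TensorRecursion

variable {𝔤 : Type} [LieRing 𝔤] [LieAlgebra ℂ 𝔤] {𝒢 : ℤ → Submodule ℂ 𝔤}

variable (𝒢) in
/-- The graph of the action of `𝒢 (-1)` on its tensor algebra by left multiplication. -/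
def graphNeg : Submodule ℂ (𝔤 × Module.End ℂ (TensorAlgebra ℂ (𝒢 (-1)))) :=
  LinearMap.range ((𝒢 (-1)).subtype.prod
    ((Algebra.lmul ℂ (TensorAlgebra ℂ (𝒢 (-1)))).toLinearMap ∘ₗ TensorAlgebra.ι ℂ))

variable (𝒢) in
/-- The graph of the action of `𝒢 0` on the tensor algebra of `𝒢 (-1)`, with weight `Λ`. -/
def graphZero (Λ : Module.Dual ℂ 𝔤) :
    Submodule ℂ (𝔤 × Module.End ℂ (TensorAlgebra ℂ (𝒢 (-1)))) where
  carrier := {s | s.1 ∈ 𝒢 0 ∧ s.2 1 = Λ s.1 • 1 ∧ ∀ t ∈ graphNeg 𝒢, ⁅s, t⁆ ∈ graphNeg 𝒢}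
  add_mem' := by
    rintro s t ⟨hs, hs', hs''⟩ ⟨ht, ht', ht''⟩
    refine ⟨add_mem hs ht, ?_, fun u hu => ?_⟩
    · rw [Prod.snd_add, LinearMap.add_apply, hs', ht', Prod.fst_add, map_add, add_smul]
    · rw [add_lie]; exact add_mem (hs'' u hu) (ht'' u hu)
  zero_mem' := ⟨zero_mem _, by simp, fun u _ => by rw [zero_lie]; exact zero_mem _⟩
  smul_mem' := by
    rintro c s ⟨hs, hs', hs''⟩
    refine ⟨Submodule.smul_mem _ c hs, ?_, fun u hu => ?_⟩
    · rw [Prod.smul_snd, LinearMap.smul_apply, hs', Prod.smul_fst, map_smul, smul_eq_mul, mul_smul]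
    · rw [smul_lie]; exact Submodule.smul_mem _ c (hs'' u hu)

variable (𝒢) in
/-- The graph of the action of `𝒢 1` on the tensor algebra of `𝒢 (-1)`. -/
def graphPos (Λ : Module.Dual ℂ 𝔤) :
    Submodule ℂ (𝔤 × Module.End ℂ (TensorAlgebra ℂ (𝒢 (-1)))) where
  carrier := {s | s.1 ∈ 𝒢 1 ∧ s.2 1 = 0 ∧ ∀ t ∈ graphNeg 𝒢, ⁅s, t⁆ ∈ graphZero 𝒢 Λ}
  add_mem' := by
    rintro s t ⟨hs, hs', hs''⟩ ⟨ht, ht', ht''⟩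
    refine ⟨add_mem hs ht, ?_, fun u hu => ?_⟩
    · rw [Prod.snd_add, LinearMap.add_apply, hs', ht', add_zero]
    · rw [add_lie]; exact add_mem (hs'' u hu) (ht'' u hu)
  zero_mem' := ⟨zero_mem _, by simp, fun u _ => by rw [zero_lie]; exact zero_mem _⟩
  smul_mem' := by
    rintro c s ⟨hs, hs', hs''⟩
    refine ⟨Submodule.smul_mem _ c hs, ?_, fun u hu => ?_⟩
    · rw [Prod.smul_snd, LinearMap.smul_apply, hs', smul_zero]
    · rw [smul_lie]; exact Submodule.smul_mem _ c (hs'' u hu)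

variable (𝒢) in
/-- The Lie algebra generated by the action of the local part. -/
def graphSpan (Λ : Module.Dual ℂ 𝔤) :
    LieSubalgebra ℂ (𝔤 × Module.End ℂ (TensorAlgebra ℂ (𝒢 (-1)))) :=
  LieSubalgebra.lieSpan ℂ _
    ((graphNeg 𝒢 : Set (𝔤 × Module.End ℂ (TensorAlgebra ℂ (𝒢 (-1))))) ∪ graphZero 𝒢 Λ ∪
      graphPos 𝒢 Λ)

variable {Λ : Module.Dual ℂ 𝔤}

theorem mem_graphNeg (f : 𝒢 (-1)) :
    ((f : 𝔤), Algebra.lmul ℂ (TensorAlgebra ℂ (𝒢 (-1))) (TensorAlgebra.ι ℂ f)) ∈ graphNeg 𝒢 :=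
  ⟨f, rfl⟩

theorem graphNeg_le {s : 𝔤 × Module.End ℂ (TensorAlgebra ℂ (𝒢 (-1)))} (h : s ∈ graphNeg 𝒢) :
    s ∈ graphSpan 𝒢 Λ :=
  LieSubalgebra.subset_lieSpan (Or.inl (Or.inl h))

theorem graphZero_le {s : 𝔤 × Module.End ℂ (TensorAlgebra ℂ (𝒢 (-1)))} (h : s ∈ graphZero 𝒢 Λ) :
    s ∈ graphSpan 𝒢 Λ :=
  LieSubalgebra.subset_lieSpan (Or.inl (Or.inr h))

theorem graphPos_le {s : 𝔤 × Module.End ℂ (TensorAlgebra ℂ (𝒢 (-1)))} (h : s ∈ graphPos 𝒢 Λ) :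
    s ∈ graphSpan 𝒢 Λ :=
  LieSubalgebra.subset_lieSpan (Or.inr h)

theorem exists_mem_graphZero (h𝒢 : IsLocallyGenerated 𝒢) {h : 𝔤} (hh : h ∈ 𝒢 0) :
    ∃ y, (h, y) ∈ graphZero 𝒢 Λ := by
  have had : ∀ f ∈ 𝒢 (-1), ⁅h, f⁆ ∈ 𝒢 (-1) := fun f hf => by simpa using h𝒢.lie_mem hh hf
  let ad : 𝒢 (-1) →ₗ[ℂ] 𝒢 (-1) :=
    LinearMap.restrict (LieModule.toEnd ℂ 𝔤 𝔤 h) had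
  obtain ⟨y, hy, hy'⟩ := exists_tensorAlgebra_rec
    ((Algebra.lmul ℂ (TensorAlgebra ℂ (𝒢 (-1)))).toLinearMap ∘ₗ TensorAlgebra.ι ℂ ∘ₗ ad)
    (Λ h • 1)
  refine ⟨y, hh, hy, ?_⟩
  rintro _ ⟨f, rfl⟩
  refine ⟨ad f, Prod.ext rfl (LinearMap.ext fun t => ?_)⟩
  change _ = y (TensorAlgebra.ι ℂ f * t) - TensorAlgebra.ι ℂ f * y t
  rw [hy', add_sub_cancel_right]
  rfl

theorem exists_mem_graphPos (h𝒢 : IsLocallyGenerated 𝒢) {e : 𝔤} (he : e ∈ 𝒢 1) :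
    ∃ y, (e, y) ∈ graphPos 𝒢 Λ := by
  have had : ∀ f ∈ 𝒢 (-1), ⁅e, f⁆ ∈ 𝒢 0 := fun f hf => by simpa using h𝒢.lie_mem he hf
  let ad : 𝒢 (-1) →ₗ[ℂ] 𝒢 0 :=
    LinearMap.restrict (LieModule.toEnd ℂ 𝔤 𝔤 e) had
  let p : graphZero 𝒢 Λ →ₗ[ℂ] 𝒢 0 :=
    LinearMap.restrict (LinearMap.fst ℂ _ _) fun s hs => hs.1
  -- A linear section is needed so that the operator attached to [e, f] depends linearly on f and
  -- can serve as the θ of the recursion.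
  obtain ⟨σ, hσ⟩ := p.exists_rightInverse_of_surjective (LinearMap.range_eq_top.mpr fun h => by
    obtain ⟨y, hy⟩ := exists_mem_graphZero (Λ := Λ) h𝒢 h.2
    exact ⟨⟨_, hy⟩, rfl⟩)
  obtain ⟨y, hy, hy'⟩ := exists_tensorAlgebra_rec
    (LinearMap.snd ℂ _ _ ∘ₗ (graphZero 𝒢 Λ).subtype ∘ₗ σ ∘ₗ ad) 0
  refine ⟨y, he, hy, ?_⟩
  rintro _ ⟨f, rfl⟩
  convert (σ (ad f)).2 using 1
  refine Prod.ext ?_ (LinearMap.ext fun t => ?_)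
  · exact (congrArg Subtype.val (LinearMap.congr_fun hσ (ad f))).symm
  · change y (TensorAlgebra.ι ℂ f * t) - TensorAlgebra.ι ℂ f * y t = _
    rw [hy', add_sub_cancel_right]
    rfl

/-- Since `graphZero` is cut out by conditions instead of formulas, closure is formal: Jacobi
handles the normalizing condition, and commutativity of degree 0 the weight on 1. -/
theorem graphZero_lie_graphZero (h𝒢 : IsLocallyGenerated 𝒢) :
    ∀ s ∈ graphZero 𝒢 Λ, ∀ t ∈ graphZero 𝒢 Λ, ⁅s, t⁆ ∈ graphZero 𝒢 Λ := by
  rintro s ⟨hs, hs', hs''⟩ t ⟨ht, ht', ht''⟩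
  have h0 := h𝒢.lie_eq_zero hs ht
  refine ⟨?_, ?_, fun u hu => ?_⟩
  · simp [h0]
  · simp [h0, LieRing.of_associative_ring_bracket, hs', ht', smul_smul, mul_comm]
  · rw [lie_lie]
    exact sub_mem (hs'' _ (ht'' u hu)) (ht'' _ (hs'' u hu))

theorem graphZero_lie_graphPos (h𝒢 : IsLocallyGenerated 𝒢) :
    ∀ s ∈ graphZero 𝒢 Λ, ∀ t ∈ graphPos 𝒢 Λ, ⁅s, t⁆ ∈ graphPos 𝒢 Λ := by
  intro s hs t ht
  refine ⟨?_, ?_, fun u hu => ?_⟩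
  · simpa using h𝒢.lie_mem hs.1 ht.1
  · simp [LieRing.of_associative_ring_bracket, hs.2.1, ht.2.1]
  · rw [lie_lie]
    refine sub_mem (graphZero_lie_graphZero h𝒢 _ hs _ (ht.2.2 u hu)) ?_
    exact ht.2.2 _ (hs.2.2 u hu)

/-- By `lieSpan_union_le` an element splits into three parts. The negative part maps into the
augmentation ideal, the positive part kills 1, and `Λ` vanishes on the first components of both;
only the degree zero part contributes, and it multiplies 1 by `Λ`. -/
theorem algebraMapInv_eq_of_mem_graphSpan (h𝒢 : IsLocallyGenerated 𝒢)
    (hΛ : ∀ k ≠ 0, ∀ x ∈ 𝒢 k, Λ x = 0) {s : 𝔤 × Module.End ℂ (TensorAlgebra ℂ (𝒢 (-1)))}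
    (hs : s ∈ graphSpan 𝒢 Λ) : TensorAlgebra.algebraMapInv (s.2 1) = Λ s.1 := by
  have key : ∀ S : Set ℤ, (∀ i ∈ S, ∀ j ∈ S, i + j ∈ S) → ∀ x ∈ ⨆ k ∈ S, 𝒢 k,
      ∀ y ∈ ⨆ k ∈ S, 𝒢 k, ⁅x, y⁆ ∈ ⨆ k ∈ S, 𝒢 k := by
    intro S hS x hx y hy
    have h1 : ∀ i ∈ S, ∀ a ∈ 𝒢 i, ∀ y ∈ ⨆ k ∈ S, 𝒢 k, ⁅a, y⁆ ∈ ⨆ k ∈ S, 𝒢 k := by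
      intro i hi a ha y hy
      have : ⨆ k ∈ S, 𝒢 k ≤ (⨆ k ∈ S, 𝒢 k).comap (LieModule.toEnd ℂ 𝔤 𝔤 a) :=
        iSup₂_le fun j hj b hb =>
          Submodule.mem_iSup_of_mem (i + j) (Submodule.mem_iSup_of_mem (hS i hi j hj)
            (h𝒢.lie_mem ha hb))
      exact this hy
    have : ⨆ k ∈ S, 𝒢 k ≤ (⨆ k ∈ S, 𝒢 k).comap (LieModule.toEnd ℂ 𝔤 𝔤 y) :=
      iSup₂_le fun i hi a ha => by
        have := h1 i hi a ha y hy
        rw [← lie_skew] at this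
        change ⁅y, a⁆ ∈ ⨆ k ∈ S, 𝒢 k
        exact neg_mem_iff.mp this
    have h2 := this hx
    rw [Submodule.mem_comap, LieModule.toEnd_apply_apply, ← lie_skew] at h2
    exact neg_mem_iff.mp h2
  have hΛS : ∀ S : Set ℤ, 0 ∉ S → ∀ x ∈ ⨆ k ∈ S, 𝒢 k, Λ x = 0 := by
    intro S hS x hx
    have : ⨆ k ∈ S, 𝒢 k ≤ LinearMap.ker Λ :=
      iSup₂_le fun k hk y hy => hΛ k (fun h => hS (h ▸ hk)) y hy
    exact this hx
  have hneg : ∀ s ∈ LieSubalgebra.lieSpan ℂ _ (graphNeg 𝒢 : Set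
      (𝔤 × Module.End ℂ (TensorAlgebra ℂ (𝒢 (-1))))), s.1 ∈ ⨆ k ∈ Set.Iio (0 : ℤ), 𝒢 k ∧
      ∀ t, TensorAlgebra.algebraMapInv (s.2 t) = 0 := by
    intro s hs
    induction hs using LieSubalgebra.lieSpan_induction with
    | mem s hs =>
      obtain ⟨f, rfl⟩ := hs
      refine ⟨Submodule.mem_iSup_of_mem (-1) (Submodule.mem_iSup_of_mem (by decide) f.2), ?_⟩
      intro t
      simp [TensorAlgebra.algebraMapInv]
    | zero => exact ⟨zero_mem _, by simp⟩
    | add s t _ _ hs ht => exact ⟨add_mem hs.1 ht.1, fun u => by simp [hs.2, ht.2]⟩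
    | smul c s _ hs => exact ⟨Submodule.smul_mem _ c hs.1, fun u => by simp [hs.2]⟩
    | lie s t _ _ hs ht =>
      refine ⟨key _ (fun i hi j hj => ?_) _ hs.1 _ ht.1, fun u => ?_⟩
      · rw [Set.mem_Iio] at *; omega
      · simp [LieRing.of_associative_ring_bracket, hs.2, ht.2]
  have hpos : ∀ s ∈ LieSubalgebra.lieSpan ℂ _ (graphPos 𝒢 Λ : Set
      (𝔤 × Module.End ℂ (TensorAlgebra ℂ (𝒢 (-1))))), s.1 ∈ ⨆ k ∈ Set.Ioi (0 : ℤ), 𝒢 k ∧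
      s.2 1 = 0 := by
    intro s hs
    induction hs using LieSubalgebra.lieSpan_induction with
    | mem s hs =>
      obtain ⟨h1, h2, -⟩ : s ∈ graphPos 𝒢 Λ := hs
      exact ⟨Submodule.mem_iSup_of_mem 1 (Submodule.mem_iSup_of_mem (by decide) h1), h2⟩
    | zero => exact ⟨zero_mem _, by simp⟩
    | add s t _ _ hs ht => exact ⟨add_mem hs.1 ht.1, by simp [hs.2, ht.2]⟩
    | smul c s _ hs => exact ⟨Submodule.smul_mem _ c hs.1, by simp [hs.2]⟩
    | lie s t _ _ hs ht =>
      refine ⟨key _ (fun i hi j hj => ?_) _ hs.1 _ ht.1, ?_⟩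
      · rw [Set.mem_Ioi] at *; omega
      · simp [LieRing.of_associative_ring_bracket, hs.2, ht.2]
  obtain ⟨t, ht, p, hp, rfl⟩ := Submodule.mem_sup.mp (lieSpan_union_le
    (P := graphNeg 𝒢) (H := graphZero 𝒢 Λ) (Q := graphPos 𝒢 Λ) (fun s hs t ht => hs.2.2 t ht)
    (graphZero_lie_graphPos h𝒢) (graphZero_lie_graphZero h𝒢)
    (fun s hs t ht => hs.2.2 t ht) hs)
  obtain ⟨m, hm, z, hz, rfl⟩ := Submodule.mem_sup.mp ht
  have h1 := hneg m hm
  have h2 := hpos p hp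
  simp [h1.2, h2.2, hz.2.1, hΛS _ (by simp) _ h1.1, hΛS _ (by simp) _ h2.1]

/-- For y over 0, the value at 1 is `Λ 0`. For a product, y(f t) = [y, f] t + f (y t): the bracket
is again over 0, and the last term lies in the augmentation ideal. -/
theorem algebraMapInv_apply_eq_zero (h𝒢 : IsLocallyGenerated 𝒢)
    (hΛ : ∀ k ≠ 0, ∀ x ∈ 𝒢 k, Λ x = 0) {y : Module.End ℂ (TensorAlgebra ℂ (𝒢 (-1)))}
    (hy : ((0 : 𝔤), y) ∈ graphSpan 𝒢 Λ) (t : TensorAlgebra ℂ (𝒢 (-1))) :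
    TensorAlgebra.algebraMapInv (y t) = 0 := by
  induction t using tensorAlgebra_induction_left generalizing y with
  | one => simpa using algebraMapInv_eq_of_mem_graphSpan h𝒢 hΛ hy
  | add t u ht hu => rw [map_add, map_add, ht hy, hu hy, add_zero]
  | smul c t ht => rw [map_smul, map_smul, ht hy, smul_zero]
  | mul f t ht =>
    have h1 := LieSubalgebra.lie_mem _ hy (graphNeg_le (Λ := Λ) (mem_graphNeg f))
    rw [LieAlgebra.Prod.bracket_apply, zero_lie] at h1
    have h2 := ht h1
    simpa [LieRing.of_associative_ring_bracket, TensorAlgebra.algebraMapInv] using h2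

theorem exists_mem_graphSpan (h𝒢 : IsLocallyGenerated 𝒢) (x : 𝔤) :
    ∃ y, (x, y) ∈ graphSpan 𝒢 Λ := by
  let 𝓟 : LieSubalgebra ℂ 𝔤 := (graphSpan 𝒢 Λ).map (LieHom.fst ℂ 𝔤 _)
  have h : ∀ k, 𝒢 k ≤ 𝓟.toSubmodule := by
    refine h𝒢.le_of_local (𝓟 := fun _ => 𝓟.toSubmodule) ?_ ?_ ?_ ?_
    · intro h hh
      obtain ⟨y, hy⟩ := exists_mem_graphZero (Λ := Λ) h𝒢 hh
      exact ⟨_, graphZero_le hy, rfl⟩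
    · intro h hh
      obtain ⟨y, hy⟩ := exists_mem_graphPos (Λ := Λ) h𝒢 hh
      exact ⟨_, graphPos_le hy, rfl⟩
    · intro h hh
      exact ⟨_, graphNeg_le (mem_graphNeg ⟨h, hh⟩), rfl⟩
    · exact fun hx hy => LieSubalgebra.lie_mem _ hx hy
  have hx : x ∈ 𝓟.toSubmodule := (h𝒢.iSup_eq_top.symm.le.trans (iSup_le h)) Submodule.mem_top
  obtain ⟨s, hs, rfl⟩ := hx
  exact ⟨s.2, hs⟩

/-- A highest weight module of weight `Λ`, with a functional that separates the highest weight
vector from the vectors of lower degree. -/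
theorem exists_highestWeightModule (h𝒢 : IsLocallyGenerated 𝒢)
    (hΛ : ∀ k ≠ 0, ∀ x ∈ 𝒢 k, Λ x = 0) :
    ∃ (X : Type) (_ : AddCommGroup X) (_ : Module ℂ X) (ρ : 𝔤 →ₗ⁅ℂ⁆ Module.End ℂ X) (v : X)
      (ε : X →ₗ[ℂ] ℂ), ε v = 1 ∧ (∀ h ∈ 𝒢 0, ρ h v = Λ h • v) ∧ (∀ e ∈ 𝒢 1, ρ e v = 0) ∧
      ∀ f ∈ 𝒢 (-1), ∀ x, ε (ρ f x) = 0 := by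
  let T := TensorAlgebra ℂ (𝒢 (-1))
  let N : Submodule ℂ T :=
    Submodule.span ℂ {u | ∃ y t, ((0 : 𝔤), y) ∈ graphSpan 𝒢 Λ ∧ y t = u}
  -- The elements lying over 0 form an ideal of `graphSpan`, so the span `N` of their images is
  -- stable.
  have hN : ∀ s ∈ graphSpan 𝒢 Λ, N ≤ N.comap s.2 := by
    intro s hs
    refine Submodule.span_le.mpr ?_
    rintro _ ⟨y, t, hy, rfl⟩
    have h1 := LieSubalgebra.lie_mem _ hs hy
    rw [LieAlgebra.Prod.bracket_apply, lie_zero] at h1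
    change s.2 (y t) ∈ N
    rw [show s.2 (y t) = ⁅s.2, y⁆ t + y (s.2 t) by
      simp [LieRing.of_associative_ring_bracket]]
    exact add_mem (Submodule.subset_span ⟨_, _, h1, rfl⟩) (Submodule.subset_span ⟨_, _, hy, rfl⟩)
  let p : (graphSpan 𝒢 Λ).toSubmodule →ₗ[ℂ] 𝔤 :=
    LinearMap.fst ℂ _ _ ∘ₗ (graphSpan 𝒢 Λ).toSubmodule.subtype
  obtain ⟨σ, hσ⟩ := p.exists_rightInverse_of_surjective (LinearMap.range_eq_top.mpr fun x => by
    obtain ⟨y, hy⟩ := exists_mem_graphSpan (Λ := Λ) h𝒢 x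
    exact ⟨⟨_, hy⟩, rfl⟩)
  have hσ1 : ∀ x, (σ x).1.1 = x := fun x => LinearMap.congr_fun hσ x
  let ρ₀ : 𝔤 →ₗ[ℂ] Module.End ℂ (T ⧸ N) :=
    { toFun := fun x => N.mapQ N (σ x).1.2 (hN _ (σ x).2)
      map_add' := fun x y => by ext t; simp
      map_smul' := fun c x => by ext t; simp }
  -- Two lifts of x differ by an element over 0, which is zero modulo `N`. So any lift computes the
  -- action, and compatibility with brackets follows although σ is only linear.
  have hρ : ∀ x y, (x, y) ∈ graphSpan 𝒢 Λ → ∀ t, ρ₀ x (N.mkQ t) = N.mkQ (y t) := by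
    intro x y hxy t
    change N.mkQ ((σ x).1.2 t) = N.mkQ (y t)
    rw [← sub_eq_zero, ← map_sub, Submodule.mkQ_apply, Submodule.Quotient.mk_eq_zero,
      ← LinearMap.sub_apply]
    refine Submodule.subset_span ⟨_, t, ?_, rfl⟩
    rw [show ((0 : 𝔤), (σ x).1.2 - y) = (σ x).1 - (x, y) from Prod.ext (by simp [hσ1]) rfl]
    exact sub_mem (σ x).2 hxy
  let ρ : 𝔤 →ₗ⁅ℂ⁆ Module.End ℂ (T ⧸ N) :=
    { ρ₀ with
      map_lie' := fun {x y} => by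
        refine LinearMap.ext fun t => ?_
        obtain ⟨t, rfl⟩ := N.mkQ_surjective t
        obtain ⟨a, ha⟩ := exists_mem_graphSpan (Λ := Λ) h𝒢 x
        obtain ⟨b, hb⟩ := exists_mem_graphSpan (Λ := Λ) h𝒢 y
        change ρ₀ ⁅x, y⁆ _ = ρ₀ x (ρ₀ y (N.mkQ t)) - ρ₀ y (ρ₀ x (N.mkQ t))
        rw [hρ ⁅x, y⁆ ⁅a, b⁆ (LieSubalgebra.lie_mem _ ha hb), hρ _ _ hb, hρ _ _ ha, hρ _ _ ha,
          hρ _ _ hb, ← map_sub]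
        rfl }
  have hN0 : N ≤ LinearMap.ker (TensorAlgebra.algebraMapInv (R := ℂ) (M := 𝒢 (-1))).toLinearMap := by
    refine Submodule.span_le.mpr ?_
    rintro _ ⟨y, t, hy, rfl⟩
    exact algebraMapInv_apply_eq_zero h𝒢 hΛ hy t
  refine ⟨T ⧸ N, inferInstance, inferInstance, ρ, N.mkQ 1, N.liftQ _ hN0, ?_, ?_, ?_, ?_⟩
  · simp
  · intro h hh
    obtain ⟨y, hy⟩ := exists_mem_graphZero (Λ := Λ) h𝒢 hh
    change ρ₀ h _ = _
    rw [hρ _ _ (graphZero_le hy), hy.2.1, map_smul]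
  · intro e he
    obtain ⟨y, hy⟩ := exists_mem_graphPos (Λ := Λ) h𝒢 he
    change ρ₀ e _ = _
    rw [hρ _ _ (graphPos_le hy), hy.2.1, map_zero]
  · intro f hf x
    obtain ⟨t, rfl⟩ := N.mkQ_surjective x
    change N.liftQ _ hN0 (ρ₀ f _) = _
    rw [hρ _ _ (graphNeg_le (mem_graphNeg ⟨f, hf⟩))]
    change TensorAlgebra.algebraMapInv (TensorAlgebra.ι ℂ ⟨f, hf⟩ * t) = 0
    simp [TensorAlgebra.algebraMapInv]

end Existence

/-! ## Verma modules and their irreducible quotients -/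

section IrreducibleQuotient

open UniversalEnvelopingAlgebra

attribute [local instance 100] LieRing.ofAssociativeRing

variable {𝔤 : Type} [LieRing 𝔤] [LieAlgebra ℂ 𝔤] {𝒢 : ℤ → Submodule ℂ 𝔤}

theorem ι_mul_mem_envPiece {k : ℤ} {x : 𝔤} (hx : x ∈ 𝒢 k) {j : ℤ}
    {u : UniversalEnvelopingAlgebra ℂ 𝔤} (hu : u ∈ envPiece 𝒢 j) :
    ι ℂ x * u ∈ envPiece 𝒢 (k + j) := by
  induction hu using Submodule.span_induction with
  | mem u hu =>
    obtain ⟨l, hl, rfl, rfl⟩ := hu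
    refine Submodule.subset_span ⟨(k, x) :: l, ?_, by simp, by simp⟩
    rintro p hp
    rcases List.mem_cons.mp hp with rfl | hp
    · exact hx
    · exact hl p hp
  | zero => rw [mul_zero]; exact zero_mem _
  | add u v _ _ hu hv => rw [mul_add]; exact add_mem hu hv
  | smul c u _ hu => rw [mul_smul_comm]; exact Submodule.smul_mem _ c hu

theorem one_mem_envPiece : (1 : UniversalEnvelopingAlgebra ℂ 𝔤) ∈ envPiece 𝒢 0 :=
  Submodule.subset_span ⟨[], by simp, by simp, by simp⟩

theorem mul_mem_envPiece {i j : ℤ} {u v : UniversalEnvelopingAlgebra ℂ 𝔤}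
    (hu : u ∈ envPiece 𝒢 i) (hv : v ∈ envPiece 𝒢 j) : u * v ∈ envPiece 𝒢 (i + j) := by
  induction hu using Submodule.span_induction with
  | mem u hu =>
    obtain ⟨l, hl, rfl, rfl⟩ := hu
    induction l with
    | nil => simpa using hv
    | cons p l ih =>
      rw [List.map_cons, List.map_cons, List.prod_cons, List.sum_cons, mul_assoc, add_assoc]
      exact ι_mul_mem_envPiece (hl p (by simp)) (ih fun p hp => hl p (by simp [hp]))
  | zero => rw [zero_mul]; exact zero_mem _
  | add u v _ _ hu hv => rw [add_mul]; exact add_mem hu hv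
  | smul c u _ hu => rw [smul_mul_assoc]; exact Submodule.smul_mem _ c hu

theorem iSup_envPiece (h𝒢 : IsLocallyGenerated 𝒢) : ⨆ j, envPiece 𝒢 j = ⊤ := by
  have hmul : ∀ x : 𝔤, ∀ u ∈ ⨆ j, envPiece 𝒢 j, ι ℂ x * u ∈ ⨆ j, envPiece 𝒢 j := by
    intro x u hu
    have hx : x ∈ ⨆ j, 𝒢 j := h𝒢.iSup_eq_top ▸ Submodule.mem_top
    induction hx using Submodule.iSup_induction' with
    | mem k x hx =>
      have : ⨆ j, envPiece 𝒢 j ≤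
          (⨆ j, envPiece 𝒢 j).comap (LinearMap.mulLeft ℂ (ι ℂ x)) :=
        iSup_le fun j u hu => Submodule.mem_iSup_of_mem (k + j) (ι_mul_mem_envPiece hx hu)
      exact this hu
    | zero => rw [map_zero, zero_mul]; exact zero_mem _
    | add x y _ _ hx hy => rw [map_add, add_mul]; exact add_mem hx hy
  refine eq_top_iff.mpr fun u _ => ?_
  obtain ⟨t, rfl⟩ : ∃ t, mkAlgHom ℂ 𝔤 t = u := Quotient.exists_rep u
  induction t using tensorAlgebra_induction_left with
  | one => rw [map_one]; exact Submodule.mem_iSup_of_mem 0 one_mem_envPiece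
  | add t u ht hu => rw [map_add]; exact add_mem (ht trivial) (hu trivial)
  | smul c t ht => rw [map_smul]; exact Submodule.smul_mem _ c (ht trivial)
  | mul v t ht => rw [map_mul]; exact hmul v _ (ht trivial)

variable (Λ : Module.Dual ℂ (𝒢 0))

/-- The highest weight vector of the Verma module. -/
def vermaVector : Verma Λ := (vermaIdeal Λ).mkQ 1

theorem mkQ_eq_smul_vermaVector (u : UniversalEnvelopingAlgebra ℂ 𝔤) :
    (vermaIdeal Λ).mkQ u = u • vermaVector Λ := by
  rw [vermaVector, ← map_smul, smul_eq_mul, mul_one]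

theorem zero_smul_vermaVector (h : 𝒢 0) : ι ℂ (h : 𝔤) • vermaVector Λ = Λ h • vermaVector Λ := by
  rw [← mkQ_eq_smul_vermaVector, ← algebraMap_smul (UniversalEnvelopingAlgebra ℂ 𝔤) (Λ h),
    ← mkQ_eq_smul_vermaVector, ← sub_eq_zero, ← map_sub, Submodule.mkQ_apply,
    Submodule.Quotient.mk_eq_zero]
  exact Submodule.subset_span (Or.inr ⟨h, rfl⟩)

theorem pos_smul_vermaVector {j : ℤ} (hj : 0 < j) {x : 𝔤} (hx : x ∈ 𝒢 j) :
    ι ℂ x • vermaVector Λ = 0 := by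
  rw [← mkQ_eq_smul_vermaVector, Submodule.mkQ_apply, Submodule.Quotient.mk_eq_zero]
  exact Submodule.subset_span (Or.inl ⟨j, hj, x, hx, rfl⟩)

theorem hwVector_eq : hwVector Λ = (maxGraded Λ).mkQ (vermaVector Λ) := rfl

theorem zero_smul_hwVector (h : 𝒢 0) : ι ℂ (h : 𝔤) • hwVector Λ = Λ h • hwVector Λ := by
  rw [hwVector_eq, ← map_smul, zero_smul_vermaVector]
  rfl

theorem pos_smul_hwVector {j : ℤ} (hj : 0 < j) {x : 𝔤} (hx : x ∈ 𝒢 j) :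
    ι ℂ x • hwVector Λ = 0 := by
  rw [hwVector_eq, ← map_smul, pos_smul_vermaVector Λ hj hx, map_zero]

theorem mem_vermaPiece {j : ℤ} {m : Verma Λ} :
    m ∈ vermaPiece Λ j ↔ ∃ u ∈ envPiece 𝒢 j, u • vermaVector Λ = m := by
  simp only [vermaPiece, Submodule.mem_map, LinearMap.coe_restrictScalars,
    mkQ_eq_smul_vermaVector]

theorem mem_irrPiece {j : ℤ} {m : Irr Λ} :
    m ∈ irrPiece Λ j ↔ ∃ u ∈ envPiece 𝒢 j, u • hwVector Λ = m := by
  simp only [irrPiece, Submodule.mem_map, LinearMap.coe_restrictScalars, mem_vermaPiece]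
  constructor
  · rintro ⟨_, ⟨u, hu, rfl⟩, rfl⟩
    exact ⟨u, hu, by rw [map_smul]; rfl⟩
  · rintro ⟨u, hu, rfl⟩
    exact ⟨_, ⟨u, hu, rfl⟩, by rw [map_smul]; rfl⟩

theorem smul_mem_vermaPiece {i j : ℤ} {u : UniversalEnvelopingAlgebra ℂ 𝔤}
    (hu : u ∈ envPiece 𝒢 i) {m : Verma Λ} (hm : m ∈ vermaPiece Λ j) :
    u • m ∈ vermaPiece Λ (i + j) := by
  obtain ⟨w, hw, rfl⟩ := (mem_vermaPiece Λ).mp hm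
  exact (mem_vermaPiece Λ).mpr ⟨u * w, mul_mem_envPiece hu hw, mul_smul _ _ _⟩

theorem vermaPiece_le_descendPiece (h𝒢 : IsLocallyGenerated 𝒢) (j : ℤ) :
    vermaPiece Λ j ≤ descendPiece 𝒢 (envRep (Verma Λ)) (ℂ ∙ vermaVector Λ) j := by
  intro m hm
  obtain ⟨u, hu, rfl⟩ := (mem_vermaPiece Λ).mp hm
  rw [← add_zero j]
  refine smul_mem_descendPiece h𝒢 ?_ ?_ hu
    (descend_le_descendPiece _ 0 (Submodule.mem_span_singleton_self _))
  · intro h hh y hy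
    obtain ⟨c, rfl⟩ := Submodule.mem_span_singleton.mp hy
    rw [smul_comm, zero_smul_vermaVector Λ ⟨h, hh⟩, smul_smul]
    exact Submodule.smul_mem _ _ (Submodule.mem_span_singleton_self _)
  · intro e he y hy
    obtain ⟨c, rfl⟩ := Submodule.mem_span_singleton.mp hy
    rw [smul_comm, pos_smul_vermaVector Λ one_pos he, smul_zero]

theorem irrPiece_le_descendPiece (h𝒢 : IsLocallyGenerated 𝒢) (j : ℤ) :
    irrPiece Λ j ≤ descendPiece 𝒢 (envRep (Irr Λ)) (ℂ ∙ hwVector Λ) j := by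
  intro m hm
  obtain ⟨u, hu, rfl⟩ := (mem_irrPiece Λ).mp hm
  rw [← add_zero j]
  refine smul_mem_descendPiece h𝒢 ?_ ?_ hu
    (descend_le_descendPiece _ 0 (Submodule.mem_span_singleton_self _))
  · intro h hh y hy
    obtain ⟨c, rfl⟩ := Submodule.mem_span_singleton.mp hy
    rw [smul_comm, zero_smul_hwVector Λ ⟨h, hh⟩, smul_smul]
    exact Submodule.smul_mem _ _ (Submodule.mem_span_singleton_self _)
  · intro e he y hy
    obtain ⟨c, rfl⟩ := Submodule.mem_span_singleton.mp hy
    rw [smul_comm, pos_smul_hwVector Λ one_pos he, smul_zero]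

/-- A functional on the Verma module that is `1` on the highest weight vector and vanishes on all
vectors of lower degree. -/
theorem exists_vermaFunctional (h𝒢 : IsLocallyGenerated 𝒢) :
    ∃ φ : Verma Λ →ₗ[ℂ] ℂ, φ (vermaVector Λ) = 1 ∧
      ∀ f ∈ 𝒢 (-1), ∀ m, φ (ι ℂ f • m) = 0 := by
  obtain ⟨π, hπ, hπ'⟩ := h𝒢.exists_proj
  -- The weight is extended by zero to all of 𝔤 through the projection π.
  obtain ⟨X, _, _, ρ, v, ε, hv, h0, h1, hm⟩ :=
    exists_highestWeightModule (Λ := Λ ∘ₗ π) h𝒢 fun k hk x hx => by simp [hπ' k hk x hx]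
  -- Only degree 1 is known to kill v; the higher degrees do because the space descending from v has
  -- no positive component.
  have hpos : ∀ j : ℤ, 0 < j → ∀ x ∈ 𝒢 j, ρ x v = 0 := by
    intro j hj x hx
    have := apply_mem_descendPiece ρ (Y := ℂ ∙ v) h𝒢 ?_ ?_ hx
      (descend_le_descendPiece _ 0 (Submodule.mem_span_singleton_self v))
    · rwa [descendPiece_of_pos ρ (by simpa using hj), Submodule.mem_bot] at this
    · intro h hh y hy
      obtain ⟨c, rfl⟩ := Submodule.mem_span_singleton.mp hy
      rw [map_smul, h0 h hh, smul_smul]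
      exact Submodule.smul_mem _ _ (Submodule.mem_span_singleton_self _)
    · intro e he y hy
      obtain ⟨c, rfl⟩ := Submodule.mem_span_singleton.mp hy
      rw [map_smul, h1 e he, smul_zero]
  let F := lift ℂ ρ
  let K : Submodule (UniversalEnvelopingAlgebra ℂ 𝔤) (UniversalEnvelopingAlgebra ℂ 𝔤) :=
    { carrier := {u | F u v = 0}
      add_mem' := fun {a b} ha hb => by
        change F (a + b) v = 0
        rw [map_add, LinearMap.add_apply, show F a v = 0 from ha, show F b v = 0 from hb, add_zero]
      zero_mem' := by change F 0 v = 0; simp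
      smul_mem' := fun c u hu => by
        change F (c * u) v = 0
        rw [map_mul, Module.End.mul_apply, show F u v = 0 from hu, map_zero] }
  have hK : vermaIdeal Λ ≤ K := by
    refine Submodule.span_le.mpr ?_
    rintro u (⟨j, hj, x, hx, rfl⟩ | ⟨h, rfl⟩)
    · change F (ι ℂ x) v = 0
      rw [lift_ι_apply, hpos j hj x hx]
    · change F (ι ℂ (h : 𝔤) - algebraMap ℂ _ (Λ h)) v = 0
      rw [map_sub, LinearMap.sub_apply, lift_ι_apply, h0 h h.2, AlgHom.commutes,
        Module.algebraMap_end_apply, LinearMap.comp_apply, hπ, sub_self]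
  let φ₀ : UniversalEnvelopingAlgebra ℂ 𝔤 →ₗ[ℂ] ℂ := ε ∘ₗ LinearMap.applyₗ v ∘ₗ F.toLinearMap
  let φ : Verma Λ →ₗ[ℂ] ℂ := ((vermaIdeal Λ).restrictScalars ℂ).liftQ φ₀ (fun u hu => by
      change ε (F u v) = 0
      rw [show F u v = 0 from hK hu, map_zero]) ∘ₗ
    (Submodule.Quotient.restrictScalarsEquiv ℂ (vermaIdeal Λ)).symm.toLinearMap
  have hφ : ∀ u, φ ((vermaIdeal Λ).mkQ u) = ε (F u v) := fun u => rfl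
  refine ⟨φ, ?_, fun f hf m => ?_⟩
  · rw [vermaVector, hφ, map_one, Module.End.one_apply, hv]
  · obtain ⟨u, rfl⟩ := (vermaIdeal Λ).mkQ_surjective m
    rw [← map_smul, hφ, smul_eq_mul, map_mul, Module.End.mul_apply, lift_ι_apply, hm f hf]

variable {Λ}

/-- Every level but the zeroth consists of images under degree -1 elements, which φ kills; the
zeroth level is `Y` itself and occurs only in degree 0. -/
theorem descendPiece_le_ker {φ : Verma Λ →ₗ[ℂ] ℂ} (hφ : ∀ f ∈ 𝒢 (-1), ∀ m, φ (ι ℂ f • m) = 0)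
    {Y : Submodule ℂ (Verma Λ)} {j : ℤ} (h : Y ≤ LinearMap.ker φ ∨ j < 0) :
    descendPiece 𝒢 (envRep (Verma Λ)) Y j ≤ LinearMap.ker φ := by
  refine iSup₂_le fun n hn => ?_
  cases n with
  | zero =>
    rcases h with h | h
    · exact h
    · simp only [Nat.cast_zero] at hn; omega
  | succ n =>
    refine Submodule.span_le.mpr ?_
    rintro _ ⟨f, hf, w, _, rfl⟩
    exact hφ f hf w

/-- A graded submodule with a nonzero component in degree 0 contains the highest weight vector and
is everything. Hence a proper one has only negative components, on which φ vanishes, and this passes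
to sums. -/
theorem maxGraded_le_ker (h𝒢 : IsLocallyGenerated 𝒢) {φ : Verma Λ →ₗ[ℂ] ℂ}
    (hφ : ∀ f ∈ 𝒢 (-1), ∀ m, φ (ι ℂ f • m) = 0) {m : Verma Λ}
    (hm : m ∈ maxGraded Λ) : φ m = 0 := by
  have key : ∀ N, IsGradedSubmodule Λ N → N ≠ ⊤ → ∀ m ∈ N, φ m = 0 := by
    intro N hN hN' m hm
    have : ⨆ j : ℤ, N.restrictScalars ℂ ⊓ vermaPiece Λ j ≤ LinearMap.ker φ := by
      refine iSup_le fun j x hx => ?_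
      have hx' := vermaPiece_le_descendPiece Λ h𝒢 j hx.2
      rcases lt_trichotomy j 0 with hj | rfl | hj
      · exact descendPiece_le_ker hφ (Or.inr hj) hx'
      · obtain ⟨c, rfl⟩ := Submodule.mem_span_singleton.mp
          (descendPiece_le_descend _ 0 hx')
        by_cases hc : c = 0
        · rw [hc, zero_smul]; exact zero_mem _
        · refine absurd (eq_top_iff.mpr fun y _ => ?_) hN'
          obtain ⟨u, rfl⟩ := (vermaIdeal Λ).mkQ_surjective y
          rw [mkQ_eq_smul_vermaVector]
          refine N.smul_mem u ?_
          have h1 := (N.restrictScalars ℂ).smul_mem c⁻¹ hx.1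
          rwa [smul_smul, inv_mul_cancel₀ hc, one_smul] at h1
      · rw [descendPiece_of_pos _ hj, Submodule.mem_bot] at hx'
        rw [hx']; exact zero_mem _
    exact this (hN hm)
  rw [maxGraded, sSup_eq_iSup'] at hm
  induction hm using Submodule.iSup_induction' with
  | mem N x hx => exact key N.1 N.2.1 N.2.2 x hx
  | zero => exact map_zero φ
  | add x y _ _ hx hy => rw [map_add, hx, hy, add_zero]

theorem hwVector_ne_zero (h𝒢 : IsLocallyGenerated 𝒢) : hwVector Λ ≠ 0 := by
  obtain ⟨φ, h1, h2⟩ := exists_vermaFunctional Λ h𝒢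
  intro h
  rw [hwVector_eq, Submodule.mkQ_apply, Submodule.Quotient.mk_eq_zero] at h
  rw [maxGraded_le_ker h𝒢 h2 h] at h1
  exact zero_ne_one h1

/-- Singular vectors generate a graded submodule obtained from `Y` by descending only. It therefore
lies in the kernel of φ, misses the highest weight vector, and is proper. -/
theorem le_maxGraded (h𝒢 : IsLocallyGenerated 𝒢) {Y : Submodule ℂ (Verma Λ)}
    (hY : Y ≤ vermaPiece Λ (-1)) (h0 : ∀ h ∈ 𝒢 0, ∀ y ∈ Y, ι ℂ h • y ∈ Y)
    (h1 : ∀ e ∈ 𝒢 1, ∀ y ∈ Y, ι ℂ e • y = 0) {y : Verma Λ} (hy : y ∈ Y) : y ∈ maxGraded Λ := by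
  obtain ⟨φ, hφ1, hφ⟩ := exists_vermaFunctional Λ h𝒢
  let N := Submodule.span (UniversalEnvelopingAlgebra ℂ 𝔤) (Y : Set (Verma Λ))
  have hN : ∀ P : Submodule ℂ (Verma Λ),
      (∀ (j : ℤ), ∀ u ∈ envPiece 𝒢 j, ∀ y ∈ Y, u • y ∈ P) → N.restrictScalars ℂ ≤ P := by
    intro P hP
    have hP' : ∀ u : UniversalEnvelopingAlgebra ℂ 𝔤, ∀ y ∈ Y, u • y ∈ P := by
      intro u y hy
      have hu : u ∈ ⨆ j, envPiece 𝒢 j := iSup_envPiece h𝒢 ▸ Submodule.mem_top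
      induction hu using Submodule.iSup_induction' with
      | mem j u hu => exact hP j u hu y hy
      | zero => rw [zero_smul]; exact zero_mem _
      | add u v _ _ hu hv => rw [add_smul]; exact add_mem hu hv
    intro x hx
    induction hx using Submodule.closure_induction with
    | zero => exact zero_mem _
    | add x y _ _ hx hy => exact add_mem hx hy
    | smul_mem u x hx => exact hP' u x hx
  have hmem : N ∈ {N | IsGradedSubmodule Λ N ∧ N ≠ ⊤} := by
    refine ⟨hN _ fun j u hu y hy => Submodule.mem_iSup_of_mem (j + -1)
      ⟨N.smul_mem u (Submodule.subset_span hy), smul_mem_vermaPiece Λ hu (hY hy)⟩, fun htop => ?_⟩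
    have hker : N.restrictScalars ℂ ≤ LinearMap.ker φ := by
      refine hN _ fun j u hu y hy => ?_
      refine descendPiece_le_ker hφ (Or.inl ?_) (smul_mem_descendPiece h𝒢 h0 h1 hu
        (descend_le_descendPiece _ 0 hy))
      exact hY.trans ((vermaPiece_le_descendPiece Λ h𝒢 (-1)).trans
        (descendPiece_le_ker hφ (Or.inr (by decide))))
    have hv : vermaVector Λ ∈ N.restrictScalars ℂ := by
      change vermaVector Λ ∈ N
      rw [htop]; exact Submodule.mem_top
    have := hker hv
    rw [LinearMap.mem_ker, hφ1] at this
    exact one_ne_zero this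
  exact (le_sSup hmem : N ≤ maxGraded Λ) (Submodule.subset_span hy)

/-- A vector of degree `-1` of the irreducible module vanishes if and only if it is singular. -/
theorem smul_hwVector_eq_zero_iff (h𝒢 : IsLocallyGenerated 𝒢) {x : 𝔤} (hx : x ∈ 𝒢 (-1)) :
    ι ℂ x • hwVector Λ = 0 ↔ ∀ e ∈ 𝒢 1, ∀ h : 𝒢 0, (h : 𝔤) = ⁅e, x⁆ → Λ h = 0 := by
  constructor
  · intro hzero e he h hh
    have h1 := map_lie_apply (envRep (Irr Λ)) e x (hwVector Λ)
    simp only [envRep_apply] at h1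
    rw [hzero, smul_zero, pos_smul_hwVector Λ one_pos he, smul_zero, add_zero, ← hh,
      zero_smul_hwVector] at h1
    exact (smul_eq_zero.mp h1.symm).resolve_right (hwVector_ne_zero h𝒢)
  · intro hsing
    -- All singular x are treated together: this space is stable under degree 0, whereas the line
    -- through a single x need not be.
    let K : Submodule ℂ 𝔤 :=
      { carrier := {x | x ∈ 𝒢 (-1) ∧ ∀ e ∈ 𝒢 1, ∀ h : 𝒢 0, (h : 𝔤) = ⁅e, x⁆ → Λ h = 0}
        add_mem' := by
          rintro x y ⟨hx, hx'⟩ ⟨hy, hy'⟩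
          refine ⟨add_mem hx hy, fun e he h hh => ?_⟩
          have hex : ⁅e, x⁆ ∈ 𝒢 0 := by simpa using h𝒢.lie_mem he hx
          have hey : ⁅e, y⁆ ∈ 𝒢 0 := by simpa using h𝒢.lie_mem he hy
          rw [show h = ⟨_, hex⟩ + ⟨_, hey⟩ from Subtype.ext (by rw [hh, lie_add]; rfl), map_add,
            hx' e he _ rfl, hy' e he _ rfl, add_zero]
        zero_mem' := ⟨zero_mem _, fun e he h hh => by
          rw [lie_zero] at hh
          rw [show h = 0 from Subtype.ext hh, map_zero]⟩
        smul_mem' := by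
          rintro c x ⟨hx, hx'⟩
          refine ⟨Submodule.smul_mem _ c hx, fun e he h hh => ?_⟩
          have hex : ⁅e, x⁆ ∈ 𝒢 0 := by simpa using h𝒢.lie_mem he hx
          rw [show h = c • ⟨_, hex⟩ from Subtype.ext (by rw [hh, lie_smul]; rfl), map_smul,
            hx' e he _ rfl, smul_zero] }
    let g : 𝔤 →ₗ[ℂ] Verma Λ :=
      LinearMap.applyₗ (vermaVector Λ) ∘ₗ (envRep (Verma Λ)).toLinearMap
    have hmem : ι ℂ x • vermaVector Λ ∈ maxGraded Λ := by
      refine le_maxGraded h𝒢 (Y := K.map g) ?_ ?_ ?_ ⟨x, ⟨hx, hsing⟩, rfl⟩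
      · rintro _ ⟨x, ⟨hx, -⟩, rfl⟩
        refine (mem_vermaPiece Λ).mpr ⟨ι ℂ x, ?_, rfl⟩
        simpa using ι_mul_mem_envPiece hx one_mem_envPiece
      · rintro h hh _ ⟨x, ⟨hx, hx'⟩, rfl⟩
        have h1 := map_lie_apply (envRep (Verma Λ)) h x (vermaVector Λ)
        change ι ℂ h • ι ℂ x • vermaVector Λ = ι ℂ ⁅h, x⁆ • vermaVector Λ +
          ι ℂ x • ι ℂ h • vermaVector Λ at h1
        change ι ℂ h • ι ℂ x • vermaVector Λ ∈ _
        rw [h1, zero_smul_vermaVector Λ ⟨h, hh⟩, smul_comm]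
        refine add_mem ⟨⁅h, x⁆, ⟨by simpa using h𝒢.lie_mem hh hx, fun e he k hk => ?_⟩, rfl⟩
          (Submodule.smul_mem _ _ ⟨x, ⟨hx, hx'⟩, rfl⟩)
        -- [e, [h, x]] = [[e, h], x] + [h, [e, x]]; the last term is a bracket inside the abelian
        -- degree 0 part, and [e, h] again has degree 1.
        rw [leibniz_lie, h𝒢.lie_eq_zero hh (by simpa using h𝒢.lie_mem he hx), add_zero] at hk
        exact hx' _ (by simpa using h𝒢.lie_mem he hh) k hk
      · rintro e he _ ⟨x, ⟨hx, hx'⟩, rfl⟩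
        have h1 := map_lie_apply (envRep (Verma Λ)) e x (vermaVector Λ)
        change ι ℂ e • ι ℂ x • vermaVector Λ = ι ℂ ⁅e, x⁆ • vermaVector Λ +
          ι ℂ x • ι ℂ e • vermaVector Λ at h1
        change ι ℂ e • ι ℂ x • vermaVector Λ = 0
        have hex : ⁅e, x⁆ ∈ 𝒢 0 := by simpa using h𝒢.lie_mem he hx
        rw [h1, pos_smul_vermaVector Λ one_pos he, smul_zero, add_zero,
          zero_smul_vermaVector Λ ⟨_, hex⟩, hx' e he _ rfl, zero_smul]
    rw [hwVector_eq, ← map_smul, Submodule.mkQ_apply, Submodule.Quotient.mk_eq_zero]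
    exact hmem

end IrreducibleQuotient

/-! ## The gradation of `Ŝ_q` -/

theorem dilate_T (a : ℂˣ) (n : ℤ) : dilate a (LaurentPolynomial.T n) =
    ((a ^ n : ℂˣ) : ℂ) • LaurentPolynomial.T n := by
  ext m
  rw [dilate_coeff, AddMonoidAlgebra.coeff_smul, Finsupp.smul_apply, LaurentPolynomial.T_apply]
  by_cases h : n = m
  · subst h; simp
  · simp [h]

section Gradation

open SAssoc

variable {q : ℂˣ}

theorem SAssoc.eq_mono {F : SAssoc q} {j : ℤ} (h : ∀ k, k ≠ j → coef k F = 0) :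
    F = mono q j (coef j F) := by
  obtain ⟨F⟩ := F
  change _ = SAssoc.mk _
  congr 1
  ext1 k
  by_cases hk : k = j
  · subst hk; exact (Finsupp.single_eq_same).symm
  · rw [Finsupp.single_eq_of_ne hk]; exact h k hk

theorem SAssoc.lie_mono_mono (k l : ℤ) (f g : ℂ[T;T⁻¹]) : ⁅mono q k f, mono q l g⁆ =
    mono q (k + l) (dilate (q ^ l) f * g - dilate (q ^ k) g * f) := by
  rw [lie_def, mono_mul_mono, mono_mul_mono, add_comm l k, map_sub]

namespace SHat

theorem op_eq_mono {x : SHat q} {j : ℤ} (hx : x ∈ gradation q j) :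
    (x.op : SAssoc q) = mono q j (coef j (x.op : SAssoc q)) := SAssoc.eq_mono hx.1

theorem op_lie_eq_mono {i j : ℤ} {x y : SHat q} (hx : x ∈ gradation q i)
    (hy : y ∈ gradation q j) : (⁅x, y⁆.op : SAssoc q) =
      mono q (i + j) (dilate (q ^ j) (coef i (x.op : SAssoc q)) * coef j (y.op : SAssoc q) -
        dilate (q ^ i) (coef j (y.op : SAssoc q)) * coef i (x.op : SAssoc q)) := by
  rw [← SAssoc.lie_mono_mono, ← op_eq_mono hx, ← op_eq_mono hy]
  rfl

theorem lie_mem_gradation {i j : ℤ} {x y : SHat q} (hx : x ∈ gradation q i)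
    (hy : y ∈ gradation q j) : ⁅x, y⁆ ∈ gradation q (i + j) := by
  refine ⟨fun k hk => ?_, fun hij => ?_⟩
  · rw [op_lie_eq_mono hx hy, coef_mono, if_neg hk.symm]
  · rw [central_lie, op_eq_mono hx, op_eq_mono hy, Psi_mono_mono, if_neg (by omega)]

theorem lie_eq_zero_of_mem_gradation_zero {x y : SHat q} (hx : x ∈ gradation q 0)
    (hy : y ∈ gradation q 0) : ⁅x, y⁆ = 0 := by
  refine SHat.ext (Subtype.ext ?_) ?_
  · rw [op_lie_eq_mono hx hy]
    simp [dilate_one, mul_comm]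
  · rw [central_lie, op_eq_mono hx, op_eq_mono hy, Psi_mono_mono]
    simp

variable (hq : ∀ n : ℤ, n ≠ 0 → q ^ n ≠ 1)

theorem zf_mem_gradation (k : ℤ) (hk : k ≠ 0) (f : ℂ[T;T⁻¹]) : zf hq k hk f ∈ gradation q k :=
  ⟨fun j hj => by simp [zf, coef_mono, hj.symm], fun _ => rfl⟩

theorem eq_zf {k : ℤ} (hk : k ≠ 0) {x : SHat q} (hx : x ∈ gradation q k) :
    x = zf hq k hk (coef k (x.op : SAssoc q)) :=
  SHat.ext (Subtype.ext (op_eq_mono hx)) (hx.2 hk)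

theorem zf_add (k : ℤ) (hk : k ≠ 0) (f g : ℂ[T;T⁻¹]) :
    zf hq k hk (f + g) = zf hq k hk f + zf hq k hk g :=
  SHat.ext (Subtype.ext (map_add _ _ _)) (add_zero 0).symm

theorem zf_smul (k : ℤ) (hk : k ≠ 0) (c : ℂ) (f : ℂ[T;T⁻¹]) :
    zf hq k hk (c • f) = c • zf hq k hk f :=
  SHat.ext (Subtype.ext (map_smul _ _ _)) (mul_zero c).symm

theorem lie_zf_zf (k l : ℤ) (hk : k ≠ 0) (hl : l ≠ 0) (hkl : k + l ≠ 0) (f g : ℂ[T;T⁻¹]) :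
    ⁅zf hq k hk f, zf hq l hl g⁆ =
      zf hq (k + l) hkl (dilate (q ^ l) f * g - dilate (q ^ k) g * f) := by
  refine SHat.ext (Subtype.ext (SAssoc.lie_mono_mono k l f g)) ?_
  change Psi (mono q k f) (mono q l g) = 0
  rw [Psi_mono_mono, if_neg (by omega)]

theorem units_pow_sub_ne_zero (hq : ∀ n : ℤ, n ≠ 0 → q ^ n ≠ 1)
    {a b : ℤ} (hab : a ≠ b) :
    ((q ^ a : ℂˣ) : ℂ) - ((q ^ b : ℂˣ) : ℂ) ≠ 0 := by
  refine sub_ne_zero.mpr fun h => hq (a - b) (sub_ne_zero.mpr hab) ?_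
  rw [zpow_sub, Units.ext h, mul_inv_cancel]

theorem gradation_add_le (hq : ∀ n : ℤ, n ≠ 0 → q ^ n ≠ 1)
    (k l : ℤ) (hk : k ≠ 0) (hl : l ≠ 0) (hkl : k + l ≠ 0) :
    gradation q (k + l) ≤
      Submodule.span ℂ {z | ∃ x ∈ gradation q k, ∃ y ∈ gradation q l, ⁅x, y⁆ = z} := by
  intro x hx
  rw [eq_zf hq hkl hx]
  generalize coef (k + l) (x.op : SAssoc q) = f
  induction f using LaurentPolynomial.induction_on' with
  | add f g hf hg => rw [zf_add]; exact add_mem hf hg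
  | C_mul_T n c =>
    rw [← LaurentPolynomial.smul_eq_C_mul, zf_smul]
    refine Submodule.smul_mem _ c ?_
    have key : ∀ a b : ℤ, a + b = n → l * a ≠ k * b → zf hq (k + l) hkl (LaurentPolynomial.T n) ∈
        Submodule.span ℂ {z | ∃ x ∈ gradation q k, ∃ y ∈ gradation q l, ⁅x, y⁆ = z} := by
      intro a b hab hne
      have h1 : ⁅zf hq k hk (LaurentPolynomial.T a), zf hq l hl (LaurentPolynomial.T b)⁆ =
          (((q ^ (l * a) : ℂˣ) : ℂ) - ((q ^ (k * b) : ℂˣ) : ℂ)) •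
            zf hq (k + l) hkl (LaurentPolynomial.T n) := by
        rw [lie_zf_zf hq k l hk hl hkl, dilate_T, dilate_T, smul_mul_assoc, smul_mul_assoc,
          ← LaurentPolynomial.T_add, ← LaurentPolynomial.T_add, add_comm b a, hab, ← sub_smul,
          zf_smul, zpow_mul, zpow_mul]
      have h2 := Submodule.smul_mem _
        (((q ^ (l * a) : ℂˣ) : ℂ) - ((q ^ (k * b) : ℂˣ) : ℂ))⁻¹
        (Submodule.subset_span (R := ℂ) (s := {z | ∃ x ∈ gradation q k, ∃ y ∈ gradation q l,
          ⁅x, y⁆ = z}) ⟨_, zf_mem_gradation hq k hk _, _, zf_mem_gradation hq l hl _, h1⟩)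
      rwa [smul_smul, inv_mul_cancel₀ (units_pow_sub_ne_zero hq hne), one_smul] at h2
    -- Any splitting n = a + b with la ≠ kb works: (0, n) unless n = 0, and then (1, -1), where l ≠
    -- -k by hypothesis.
    by_cases hn : n = 0
    · exact key 1 (-1) (by omega) (by omega)
    · exact key 0 n (zero_add n) (by rw [mul_zero]; exact (mul_ne_zero hk hn).symm)

/-- Every element of 𝒮_q lies in 𝒮'_q up to its degree 0 coefficient. This makes the degree 0
projection preserve 𝒮'_q without describing the degree 0 part of 𝒮'_q. -/
theorem exists_mem_iSup_gradation (hq : ∀ n : ℤ, n ≠ 0 → q ^ n ≠ 1)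
    (F : SAssoc q) : ∃ y ∈ ⨆ j, gradation q j,
    (y.op : SAssoc q) = F - mono q 0 (coef 0 F) ∧ y.central = 0 := by
  induction F using SAssoc.induction with
  | h0 => exact ⟨0, zero_mem _, by simp, rfl⟩
  | hadd F G hF hG =>
    obtain ⟨x, hx, hx', hx''⟩ := hF
    obtain ⟨y, hy, hy', hy''⟩ := hG
    refine ⟨x + y, add_mem hx hy, ?_, by simp [hx'', hy'']⟩
    rw [op_add, Submodule.coe_add, hx', hy', map_add, map_add]
    abel
  | hmono k f =>
    by_cases hk : k = 0
    · subst hk; exact ⟨0, zero_mem _, by simp [coef_mono], rfl⟩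
    · exact ⟨zf hq k hk f, Submodule.mem_iSup_of_mem k (zf_mem_gradation hq k hk f),
        by simp [zf, coef_mono, hk], rfl⟩

theorem mono_coef_mem_derived (hq : ∀ n : ℤ, n ≠ 0 → q ^ n ≠ 1)
    {F : SAssoc q} (hF : F ∈ derived q) :
    mono q 0 (coef 0 F) ∈ derived q := by
  obtain ⟨y, -, hy, -⟩ := exists_mem_iSup_gradation hq F
  rw [show mono q 0 (coef 0 F) = F - y.op by rw [hy]; abel]
  exact sub_mem hF y.op.2

/-- The projection of `Ŝ_q` onto its component of degree zero. -/
def projZero : SHat q →ₗ[ℂ] gradation q 0 where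
  toFun x := ⟨⟨⟨mono q 0 (coef 0 (x.op : SAssoc q)), mono_coef_mem_derived hq x.op.2⟩, x.central⟩,
    fun k hk => by simp [coef_mono, hk.symm], fun h => absurd rfl h⟩
  map_add' x y := Subtype.ext (SHat.ext (Subtype.ext (by simp)) rfl)
  map_smul' c x := Subtype.ext (SHat.ext (Subtype.ext (by simp)) rfl)

theorem projZero_coe (h : gradation q 0) : projZero hq h = h :=
  Subtype.ext (SHat.ext (Subtype.ext (op_eq_mono h.2).symm) rfl)

theorem projZero_of_mem {k : ℤ} (hk : k ≠ 0) {x : SHat q} (hx : x ∈ gradation q k) :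
    projZero hq x = 0 :=
  Subtype.ext (SHat.ext (Subtype.ext (by simp [projZero, hx.1 0 hk.symm])) (hx.2 hk))

theorem iSup_gradation (hq : ∀ n : ℤ, n ≠ 0 → q ^ n ≠ 1) : ⨆ j, gradation q j = ⊤ := by
  refine eq_top_iff.mpr fun x _ => ?_
  obtain ⟨y, hy, hy', hy''⟩ := exists_mem_iSup_gradation hq (x.op : SAssoc q)
  have : x = projZero hq x + y := by
    refine SHat.ext (Subtype.ext ?_) ?_
    · rw [op_add, Submodule.coe_add, hy']
      simp [projZero]
    · rw [central_add, hy'', add_zero]; rfl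
  rw [this]
  exact add_mem (Submodule.mem_iSup_of_mem 0 (projZero hq x).2) hy

theorem isLocallyGenerated_gradation (hq : ∀ n : ℤ, n ≠ 0 → q ^ n ≠ 1) :
    IsLocallyGenerated (gradation q) where
  lie_mem := lie_mem_gradation
  lie_eq_zero := lie_eq_zero_of_mem_gradation_zero
  iSup_eq_top := iSup_gradation hq
  pos_le k hk := gradation_add_le hq 1 k one_ne_zero hk.ne' (by omega)
  neg_le k hk := gradation_add_le hq (-1) k (by decide) hk.ne (by omega)
  exists_proj := ⟨projZero hq, projZero_coe hq, fun _ hk _ hx => projZero_of_mem hq hk hx⟩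

end SHat

end Gradation

/-! ## The equation for the labels -/

section Labels

open SAssoc SHat Polynomial

variable {q : ℂˣ} (hq : ∀ n : ℤ, n ≠ 0 → q ^ n ≠ 1) (Λ : Module.Dual ℂ (SHat.gradation q 0))

/-- The sequence `(1 - qⁿ) Δₙ + c δ_{n,0}`. -/
def labelSeq : ℤ → ℂ := fun n =>
  if hn : n = 0 then centralCharge Λ else (1 - (q : ℂ) ^ n) * label hq Λ n hn

theorem labelSeq_zero : labelSeq hq Λ 0 = centralCharge Λ := dif_pos rfl

theorem labelSeq_of_ne {n : ℤ} (hn : n ≠ 0) :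
    labelSeq hq Λ n = (1 - (q : ℂ) ^ n) * label hq Λ n hn := dif_neg hn

/-- The coefficient of xⁿ in the series is `labelSeq` at -n, as Δ_Λ is expanded in x⁻ⁿ. The sign
reversal turns multiplication by xʲ into the j-fold shift. -/
theorem satisfiesEquation_iff (b : ℂ[X]) :
    SatisfiesEquation hq Λ b ↔ aeval shift b (labelSeq hq Λ) = 0 := by
  have hs : ∀ n, (genSeries hq Λ - substSeries q⁻¹ (genSeries hq Λ) +
      constSeries (centralCharge Λ)) n = labelSeq hq Λ (-n) := by
    intro n
    by_cases hn : n = 0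
    · subst hn
      simp [genSeries, substSeries, constSeries, labelSeq]
    · have hn' : -n ≠ 0 := neg_ne_zero.mpr hn
      rw [labelSeq_of_ne hq Λ hn']
      simp [genSeries, substSeries, constSeries, hn]
      ring
  have h : ∀ n, polyMulSeries b (genSeries hq Λ - substSeries q⁻¹ (genSeries hq Λ) +
      constSeries (centralCharge Λ)) n = aeval shift b (labelSeq hq Λ) (-n) := by
    intro n
    rw [aeval_shift_apply, polyMulSeries]
    simp only [hs, neg_sub]
    simp only [sub_eq_neg_add]
  rw [SatisfiesEquation]
  constructor
  · intro h0
    funext n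
    rw [← neg_neg n, ← h, h0]
    rfl
  · intro h0
    funext n
    rw [h, h0]
    rfl

/-- For m + j ≠ 0 the commutator contributes q⁻ᵐ - qʲ = q⁻ᵐ(1 - q^(m + j)); for m + j = 0 it
vanishes and the cocycle contributes q⁻ᵐ. Both cases have the same form, which is why c is the value
of the sequence at 0. Composing with `projZero` keeps the expression bilinear, with no membership
proofs to carry. -/
theorem projZero_lie_zf (m j : ℤ) :
    Λ (projZero hq ⁅zf hq 1 one_ne_zero (LaurentPolynomial.T m),
      zf hq (-1) (by decide) (LaurentPolynomial.T j)⁆) =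
      ((q ^ (-m) : ℂˣ) : ℂ) * labelSeq hq Λ (m + j) := by
  have hop : ((⁅zf hq 1 one_ne_zero (LaurentPolynomial.T m),
      zf hq (-1) (by decide) (LaurentPolynomial.T j)⁆ : SHat q).op : SAssoc q) =
      (((q ^ (-m) : ℂˣ) : ℂ) - ((q ^ j : ℂˣ) : ℂ)) • mono q 0 (LaurentPolynomial.T (m + j)) := by
    refine (SAssoc.lie_mono_mono 1 (-1) _ _).trans ?_
    rw [dilate_T, dilate_T, smul_mul_assoc, smul_mul_assoc, ← LaurentPolynomial.T_add,
      ← LaurentPolynomial.T_add, add_comm j m, ← sub_smul, map_smul, ← zpow_mul, ← zpow_mul,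
      neg_one_mul, one_mul]
    rfl
  have hc : (⁅zf hq 1 one_ne_zero (LaurentPolynomial.T m),
      zf hq (-1) (by decide) (LaurentPolynomial.T j)⁆ : SHat q).central =
      if m + j = 0 then ((q ^ (-m) : ℂˣ) : ℂ) else 0 := by
    refine (Psi_mono_mono 1 (-1) _ _).trans ?_
    rw [dilate_T, smul_mul_assoc, ← LaurentPolynomial.T_add, ← zpow_mul, neg_one_mul]
    simp [trZero, LaurentPolynomial.T_apply]
  by_cases h : m + j = 0
  · rw [if_pos h] at hc
    have hj : j = -m := by omega
    rw [hj, sub_self, zero_smul, ← hj] at hop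
    have : projZero hq ⁅zf hq 1 one_ne_zero (LaurentPolynomial.T m),
        zf hq (-1) (by decide) (LaurentPolynomial.T j)⁆ = ((q ^ (-m) : ℂˣ) : ℂ) • SHat.C q := by
      refine Subtype.ext (SHat.ext (Subtype.ext ?_) ?_)
      · change mono q 0 (coef 0 _) =
          ((((q ^ (-m) : ℂˣ) : ℂ) • SHat.C q : gradation q 0).1.op : SAssoc q)
        rw [hop]
        simp [SHat.C]
      · refine hc.trans ?_
        simp [SHat.C]
    rw [this, map_smul, h, labelSeq_zero]
    rfl
  · rw [if_neg h] at hc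
    have : projZero hq ⁅zf hq 1 one_ne_zero (LaurentPolynomial.T m),
        zf hq (-1) (by decide) (LaurentPolynomial.T j)⁆ =
        (((q ^ (-m) : ℂˣ) : ℂ) - ((q ^ j : ℂˣ) : ℂ)) • Tq hq (m + j) h := by
      refine Subtype.ext (SHat.ext (Subtype.ext ?_) ?_)
      · change mono q 0 (coef 0 _) =
          (((((q ^ (-m) : ℂˣ) : ℂ) - ((q ^ j : ℂˣ) : ℂ)) • Tq hq (m + j) h :
            gradation q 0).1.op : SAssoc q)
        rw [hop, map_smul, coef_mono, if_pos rfl, map_smul]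
        rfl
      · refine hc.trans ?_
        simp [Tq]
    rw [this, map_smul, labelSeq_of_ne hq Λ h, smul_eq_mul, ← mul_assoc]
    congr 1
    rw [mul_sub, mul_one, Units.val_zpow_eq_zpow_val, Units.val_zpow_eq_zpow_val,
      ← zpow_add₀ q.ne_zero, neg_add_cancel_left]

theorem projZero_lie_zf_toLaurent (m : ℤ) (b : ℂ[X]) :
    Λ (projZero hq ⁅zf hq 1 one_ne_zero (LaurentPolynomial.T m),
      zf hq (-1) (by decide) (toLaurent b)⁆) =
      ((q ^ (-m) : ℂˣ) : ℂ) * aeval shift b (labelSeq hq Λ) m := by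
  induction b using Polynomial.induction_on' with
  | add b c hb hc =>
    rw [map_add, zf_add, lie_add, map_add, map_add, hb, hc, map_add, LinearMap.add_apply,
      Pi.add_apply, mul_add]
  | monomial n c =>
    rw [toLaurent_C_mul_T, ← LaurentPolynomial.smul_eq_C_mul, zf_smul, lie_smul, map_smul,
      map_smul, projZero_lie_zf, aeval_shift_apply, sum_monomial_index _ _ (by simp), smul_eq_mul]
    ring

/-- By the singular vector criterion, it is enough to pair with z T_qᵐ for all m, since these span
degree 1; each pairing is one term of the recurrence up to the unit q⁻ᵐ. -/
theorem killsHighestWeightVector_iff (b : ℂ[X]) :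
    KillsHighestWeightVector hq Λ b ↔ SatisfiesEquation hq Λ b := by
  rw [KillsHighestWeightVector, smul_hwVector_eq_zero_iff (isLocallyGenerated_gradation hq)
    (zf_mem_gradation hq _ _ _), satisfiesEquation_iff]
  constructor
  · intro h
    funext m
    have h1 := projZero_lie_zf_toLaurent hq Λ m b
    have hmem := lie_mem_gradation (zf_mem_gradation hq 1 one_ne_zero (LaurentPolynomial.T m))
      (zf_mem_gradation hq (-1) (by decide) (toLaurent b))
    rw [projZero_coe hq ⟨_, hmem⟩, h _ (zf_mem_gradation hq 1 one_ne_zero _) ⟨_, hmem⟩ rfl] at h1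
    exact (mul_eq_zero.mp h1.symm).resolve_left (Units.ne_zero _)
  · intro h e he k hk
    rw [← projZero_coe hq k, hk, eq_zf hq one_ne_zero he]
    generalize coef 1 (e.op : SAssoc q) = f
    induction f using LaurentPolynomial.induction_on' with
    | add f g hf hg => rw [zf_add, add_lie, map_add, map_add, hf, hg, add_zero]
    | C_mul_T n c =>
      rw [← LaurentPolynomial.smul_eq_C_mul, zf_smul, smul_lie, map_smul, map_smul,
        projZero_lie_zf_toLaurent, h]
      simp

end Labels

/-! ## Quasifiniteness -/

section Laurent

open Polynomial

/-- Up to a power of T, B is a nonzero polynomial. So T is algebraic in the quotient, hence so is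
T⁻¹, and the two generate it. -/
instance finite_quotient_span_singleton {B : ℂ[T;T⁻¹]} [hB : NeZero B] :
    Module.Finite ℂ (ℂ[T;T⁻¹] ⧸ Ideal.span {B}) := by
  let π := Ideal.Quotient.mkₐ ℂ (Ideal.span {B})
  have hinv : ∀ n : ℤ, π (LaurentPolynomial.T n) * π (LaurentPolynomial.T (-n)) = 1 := fun n => by
    rw [← map_mul, ← LaurentPolynomial.T_add, add_neg_cancel, LaurentPolynomial.T_zero, map_one]
  have h1 : IsAlgebraic ℂ (π (LaurentPolynomial.T 1)) := by
    obtain ⟨N, p, hp⟩ := LaurentPolynomial.exists_T_pow B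
    refine ⟨p, fun h => ?_, ?_⟩
    · rw [h, map_zero] at hp
      have := congrArg (· * LaurentPolynomial.T (-(N : ℤ))) hp
      simp only [zero_mul, mul_assoc, ← LaurentPolynomial.T_add, add_neg_cancel,
        LaurentPolynomial.T_zero, mul_one] at this
      exact hB.out this.symm
    · have : aeval (π (LaurentPolynomial.T 1)) p = π (toLaurent p) := by
        have : aeval (π (LaurentPolynomial.T 1)) = π.comp (toLaurentAlg (R := ℂ)) :=
          Polynomial.algHom_ext (by simp)
        rw [this]; rfl
      rw [this, hp, map_mul, show π B = 0 from
        Ideal.Quotient.eq_zero_iff_mem.mpr (Ideal.mem_span_singleton_self B), zero_mul]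
  let _ : Invertible (π (LaurentPolynomial.T 1)) :=
    ⟨π (LaurentPolynomial.T (-1)), by rw [mul_comm]; exact hinv 1, hinv 1⟩
  have h2 : IsAlgebraic ℂ (π (LaurentPolynomial.T (-1))) := h1.invOf
  have hfin := Algebra.finite_adjoin_of_finite_of_isIntegral (R := ℂ)
    (s := {π (LaurentPolynomial.T 1), π (LaurentPolynomial.T (-1))}) (Set.toFinite _) (by
      rintro x (rfl | rfl)
      · exact h1.isIntegral
      · exact h2.isIntegral)
  have htop : Algebra.adjoin ℂ {π (LaurentPolynomial.T 1), π (LaurentPolynomial.T (-1))} = ⊤ := by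
    refine eq_top_iff.mpr fun x _ => ?_
    obtain ⟨f, rfl⟩ := Ideal.Quotient.mkₐ_surjective ℂ (Ideal.span {B}) x
    change π f ∈ _
    induction f using LaurentPolynomial.induction_on' with
    | add f g hf hg => rw [map_add]; exact add_mem (hf trivial) (hg trivial)
    | C_mul_T n c =>
      rw [← LaurentPolynomial.smul_eq_C_mul, map_smul]
      refine Subalgebra.smul_mem _ ?_ c
      obtain ⟨k, rfl | rfl⟩ := n.eq_nat_or_neg
      · rw [show (k : ℤ) = k * 1 by ring, ← LaurentPolynomial.T_pow, map_pow]
        exact pow_mem (Algebra.subset_adjoin (by simp)) k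
      · rw [show -(k : ℤ) = k * (-1) by ring, ← LaurentPolynomial.T_pow, map_pow]
        exact pow_mem (Algebra.subset_adjoin (by simp)) k
  rw [htop] at hfin
  exact Module.Finite.equiv (Subalgebra.topEquiv (R := ℂ)).toLinearEquiv

theorem finiteDimensional_range_of_mul_eq_zero {M : Type*} [AddCommGroup M] [Module ℂ M]
    (g : ℂ[T;T⁻¹] →ₗ[ℂ] M) {B : ℂ[T;T⁻¹]} (hB : B ≠ 0) (h : ∀ f, g (B * f) = 0) :
    FiniteDimensional ℂ (LinearMap.range g) := by
  have : NeZero B := ⟨hB⟩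
  let e := Submodule.Quotient.restrictScalarsEquiv ℂ (Ideal.span {B})
  have hle : (Ideal.span {B}).restrictScalars ℂ ≤ LinearMap.ker g := by
    intro f hf
    obtain ⟨f', rfl⟩ := Ideal.mem_span_singleton.mp hf
    exact h f'
  have := Module.Finite.equiv e.symm
  rw [← Submodule.range_liftQ _ g hle]
  infer_instance

theorem dilate_ne_zero (a : ℂˣ) {f : ℂ[T;T⁻¹]} (hf : f ≠ 0) : dilate a f ≠ 0 := fun h => hf (by
  rw [← dilate_one f, ← inv_mul_cancel a, ← dilate_dilate, h, map_zero])

end Laurent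

/-! ### From annihilators of the highest weight vector to finite dimension, and minimal polynomials
-/

section Quasifinite

open SAssoc SHat Polynomial UniversalEnvelopingAlgebra

attribute [local instance 100] LieRing.ofAssociativeRing

variable {q : ℂˣ} (hq : ∀ n : ℤ, n ≠ 0 → q ^ n ≠ 1) {Λ : Module.Dual ℂ (SHat.gradation q 0)}

theorem IsQuasifinite.exists_killsHighestWeightVector (h : IsQuasifinite Λ) :
    ∃ b : ℂ[X], b ≠ 0 ∧ KillsHighestWeightVector hq Λ b := by
  by_contra! hne
  let g₀ : ℂ[X] →ₗ[ℂ] Irr Λ :=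
    { toFun := fun b => ι ℂ (zf hq (-1) (by decide) (toLaurent b)) • hwVector Λ
      map_add' := fun a b => by rw [map_add, zf_add, map_add, add_smul]
      map_smul' := fun c b => by
        rw [Polynomial.smul_eq_C_mul, map_mul, toLaurent_C, ← LaurentPolynomial.smul_eq_C_mul,
          zf_smul, map_smul, smul_assoc]
        rfl }
  let g : ℂ[X] →ₗ[ℂ] irrPiece Λ (-1) := g₀.codRestrict _ fun b =>
    (mem_irrPiece Λ).mpr ⟨_, by
      simpa using ι_mul_mem_envPiece (zf_mem_gradation hq (-1) (by decide) (toLaurent b))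
        one_mem_envPiece, rfl⟩
  have := h (-1)
  refine Polynomial.not_finite (R := ℂ) (Module.Finite.of_injective g ?_)
  rw [← LinearMap.ker_eq_bot, LinearMap.ker_eq_bot']
  intro b hb
  by_contra hb0
  exact hne b hb0 (congrArg Subtype.val hb)

/-- [T_qⁿ, zᵏ f] = (q^(kn) - 1) zᵏ f T_qⁿ with nonzero factor for n ≠ 0, and T_qⁿ acts on the
highest weight vector by a scalar. So the f killing it form an ideal. -/
theorem zf_mul_smul_hwVector {k : ℤ} (hk : k ≠ 0) {f : ℂ[T;T⁻¹]}
    (hf : ι ℂ (zf hq k hk f) • hwVector Λ = 0) (g : ℂ[T;T⁻¹]) :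
    ι ℂ (zf hq k hk (f * g)) • hwVector Λ = 0 := by
  induction g using LaurentPolynomial.induction_on' with
  | add g g' hg hg' => rw [mul_add, zf_add, map_add, add_smul, hg, hg', add_zero]
  | C_mul_T n c =>
    rw [← LaurentPolynomial.smul_eq_C_mul, mul_smul_comm, zf_smul, map_smul, smul_assoc]
    by_cases hn : n = 0
    · rw [hn, LaurentPolynomial.T_zero, mul_one, hf, smul_zero]
    · have hlie : ⁅(Tq hq n hn : SHat q), zf hq k hk f⁆ =
          (((q ^ (k * n) : ℂˣ) : ℂ) - ((q ^ (0 : ℤ) : ℂˣ) : ℂ)) •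
            zf hq k hk (f * LaurentPolynomial.T n) := by
        refine SHat.ext (Subtype.ext ?_) ?_
        · refine (SAssoc.lie_mono_mono 0 k (LaurentPolynomial.T n) f).trans ?_
          rw [dilate_T, zpow_zero, dilate_one, smul_mul_assoc, mul_comm _ f, zero_add, zpow_mul,
            Units.val_one]
          change _ = ((((q ^ k) ^ n : ℂˣ) : ℂ) - 1) • mono q k (f * LaurentPolynomial.T n)
          rw [map_sub, map_smul, sub_smul, one_smul]
        · refine (Psi_mono_mono 0 k _ f).trans ?_
          simp [zf]
      have h1 := map_lie_apply (envRep (Irr Λ)) (Tq hq n hn : SHat q) (zf hq k hk f) (hwVector Λ)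
      simp only [envRep_apply] at h1
      rw [hf, smul_zero, zero_smul_hwVector, smul_comm, hf, smul_zero, add_zero, hlie, map_smul,
        smul_assoc] at h1
      rw [(smul_eq_zero.mp h1.symm).resolve_left
        (units_pow_sub_ne_zero hq (mul_ne_zero hk hn)), smul_zero]

/-- Two operators that kill the highest weight vector have a bracket that kills it; bracketing with
degree -1 moves from one degree to the next, provided the bracket is nonzero. -/
theorem exists_zf_mul_smul_hwVector {b : ℂ[X]} (hb : b ≠ 0)
    (hkill : KillsHighestWeightVector hq Λ b) (k : ℕ) :
    ∃ B : ℂ[T;T⁻¹], B ≠ 0 ∧ ∀ g,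
      ι ℂ (zf hq (-1 - k) (by omega) (B * g)) • hwVector Λ = 0 := by
  induction k with
  | zero =>
    refine ⟨toLaurent b, fun h => hb (toLaurent_injective (by rw [h, map_zero])), fun g => ?_⟩
    refine zf_mul_smul_hwVector hq _ ?_ g
    have : zf hq (-1 - ((0 : ℕ) : ℤ)) (by omega) (toLaurent b) =
        zf hq (-1) (by decide) (toLaurent b) := by simp [zf]
    rw [this]
    exact hkill
  | succ k ih =>
    obtain ⟨B, hB, hB'⟩ := ih
    have hb' : toLaurent b ≠ 0 := fun h => hb (toLaurent_injective (by rw [h, map_zero]))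
    have hne1 : (-1 : ℤ) - k ≠ 0 := by omega
    have hne2 : (-1 : ℤ) - k + -1 ≠ 0 := by omega
    let A : ℤ → ℂ[T;T⁻¹] := fun m =>
      dilate (q ^ (-1 : ℤ)) B * (toLaurent b * LaurentPolynomial.T m) -
        dilate (q ^ (-1 - k : ℤ)) (toLaurent b * LaurentPolynomial.T m) * B
    have hA : ∀ m, ι ℂ (zf hq (-1 - k + -1) hne2 (A m)) • hwVector Λ = 0 := by
      intro m
      have h1 := map_lie_apply (envRep (Irr Λ)) (zf hq (-1 - k) hne1 (B * 1))
        (zf hq (-1) (by decide) (toLaurent b * LaurentPolynomial.T m)) (hwVector Λ)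
      simp only [envRep_apply] at h1
      rw [hB', zf_mul_smul_hwVector hq _ hkill, smul_zero, smul_zero, add_zero,
        lie_zf_zf hq _ _ hne1 (by decide) hne2, mul_one] at h1
      exact h1.symm
    -- If `A 0` and `A 1` both vanished, eliminating the first product would leave (1 - q^(-1-k))
    -- times a product of nonzero Laurent polynomials equal to zero.
    obtain ⟨m, hm⟩ : ∃ m, A m ≠ 0 := by
      by_contra! hA0
      have h0 := hA0 0
      have h1 := hA0 1
      simp only [A, LaurentPolynomial.T_zero, mul_one] at h0
      simp only [A, map_mul, dilate_T, zpow_one] at h1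
      have h2 : (((q ^ (0 : ℤ) : ℂˣ) : ℂ) - ((q ^ (-1 - k : ℤ) : ℂˣ) : ℂ)) •
          (dilate (q ^ (-1 - k : ℤ)) (toLaurent b) * B * LaurentPolynomial.T 1) = 0 := by
        rw [zpow_zero, Units.val_one, sub_smul, one_smul]
        rw [sub_eq_zero] at h0
        rw [← mul_assoc, h0, mul_smul_comm, smul_mul_assoc] at h1
        rw [← h1]
        congr 2
        ring
      have h3 := (smul_eq_zero.mp h2).resolve_left (units_pow_sub_ne_zero hq (by omega))
      have hT : (LaurentPolynomial.T 1 : ℂ[T;T⁻¹]) ≠ 0 :=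
        (LaurentPolynomial.isUnit_T 1).ne_zero
      exact mul_ne_zero (mul_ne_zero (dilate_ne_zero _ hb') hB) hT h3
    refine ⟨A m, hm, fun g => ?_⟩
    have e : zf hq (-1 - ((k + 1 : ℕ) : ℤ)) (by omega) (A m * g) =
        zf hq (-1 - k + -1) hne2 (A m * g) := by
      have : (-1 : ℤ) - ((k + 1 : ℕ) : ℤ) = -1 - k + -1 := by push_cast; ring
      simp only [this]
    rw [e]
    exact zf_mul_smul_hwVector hq _ (hA m) g

/-- All negative degrees k are carried along because passing from w to x w with x of degree -1 uses
the annihilators of w in degrees k and k - 1. -/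
theorem exists_zf_mul_smul_descend {M : Type*} [AddCommGroup M] [Module ℂ M]
    (ρ : SHat q →ₗ⁅ℂ⁆ Module.End ℂ M) {v : M}
    (hv : ∀ k (hk : k < 0), ∃ B : ℂ[T;T⁻¹], B ≠ 0 ∧ ∀ g, ρ (zf hq k hk.ne (B * g)) v = 0)
    {n : ℕ} {u : M} (hu : u ∈ descend (gradation q) ρ (ℂ ∙ v) n) (k : ℤ) (hk : k < 0) :
    ∃ B : ℂ[T;T⁻¹], B ≠ 0 ∧ ∀ g, ρ (zf hq k hk.ne (B * g)) u = 0 := by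
  induction n generalizing u k with
  | zero =>
    obtain ⟨c, rfl⟩ := Submodule.mem_span_singleton.mp hu
    obtain ⟨B, hB, hB'⟩ := hv k hk
    exact ⟨B, hB, fun g => by rw [map_smul, hB', smul_zero]⟩
  | succ n ih =>
    induction hu using Submodule.span_induction with
    | mem u hu =>
      obtain ⟨x, hx, w, hw, rfl⟩ := hu
      obtain ⟨B, hB, hB'⟩ := ih hw k hk
      obtain ⟨D, hD, hD'⟩ := ih hw (k + -1) (by omega)
      -- The factor `B` kills the term x zᵏ(⋯) w. In the bracket with z⁻¹ f, one summand is dilated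
      -- by q⁻¹ and the other keeps its argument, so `dilate q D` and `D` respectively make both
      -- divisible by `D`.
      refine ⟨B * D * dilate q D, mul_ne_zero (mul_ne_zero hB hD) (dilate_ne_zero q hD),
        fun g => ?_⟩
      rw [eq_zf hq (by decide) hx, map_lie_apply, lie_zf_zf hq k (-1) hk.ne (by decide) (by omega)]
      generalize coef (-1) (x.op : SAssoc q) = f
      have e1 : ρ (zf hq k hk.ne (B * D * dilate q D * g)) w = 0 := by
        rw [mul_assoc, mul_assoc]; exact hB' _
      have e2 : dilate (q ^ (-1 : ℤ)) (B * D * dilate q D * g) * f -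
          dilate (q ^ k) f * (B * D * dilate q D * g) =
          D * (dilate (q ^ (-1 : ℤ)) (B * D * g) * f - dilate (q ^ k) f * (B * dilate q D * g)) := by
        have : dilate (q ^ (-1 : ℤ)) (dilate q D) = D := by
          rw [dilate_dilate, zpow_neg_one, inv_mul_cancel, dilate_one]
        simp only [map_mul, this]
        ring
      rw [e1, map_zero, add_zero, e2]
      exact hD' _
    | zero => exact ⟨1, one_ne_zero, fun g => map_zero _⟩
    | add u v _ _ hu hv =>
      obtain ⟨B, hB, hB'⟩ := hu
      obtain ⟨D, hD, hD'⟩ := hv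
      refine ⟨B * D, mul_ne_zero hB hD, fun g => ?_⟩
      have e1 := hB' (D * g)
      have e2 := hD' (B * g)
      rw [← mul_assoc] at e1 e2
      rw [mul_comm D B] at e2
      rw [map_add, e1, e2, add_zero]
    | smul c u _ hu =>
      obtain ⟨B, hB, hB'⟩ := hu
      exact ⟨B, hB, fun g => by rw [map_smul, hB', smul_zero]⟩

/-- The next level is the sum, over a finite spanning set of u, of the images of f ↦ (z⁻¹ f) u; each
such map vanishes on a nonzero ideal. -/
theorem finiteDimensional_descend {M : Type*} [AddCommGroup M] [Module ℂ M]
    (ρ : SHat q →ₗ⁅ℂ⁆ Module.End ℂ M) {v : M}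
    (hv : ∀ k (hk : k < 0), ∃ B : ℂ[T;T⁻¹], B ≠ 0 ∧ ∀ g, ρ (zf hq k hk.ne (B * g)) v = 0)
    (n : ℕ) : FiniteDimensional ℂ (descend (gradation q) ρ (ℂ ∙ v) n) := by
  induction n with
  | zero => exact inferInstanceAs (FiniteDimensional ℂ (ℂ ∙ v))
  | succ n ih =>
    obtain ⟨s, hs⟩ := Module.Finite.iff_fg.mp ih
    let g : M → ℂ[T;T⁻¹] →ₗ[ℂ] M := fun u =>
      { toFun := fun f => ρ (zf hq (-1) (by decide) f) u
        map_add' := fun f g => by rw [zf_add, map_add, LinearMap.add_apply]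
        map_smul' := fun c f => by rw [zf_smul, map_smul, LinearMap.smul_apply]; rfl }
    have hfg : (⨆ u ∈ s, LinearMap.range (g u)).FG := by
      refine Submodule.fg_biSup s _ fun u hu => ?_
      have hu' : u ∈ descend (gradation q) ρ (ℂ ∙ v) n := hs ▸ Submodule.subset_span hu
      obtain ⟨B, hB, hB'⟩ := exists_zf_mul_smul_descend hq ρ hv hu' (-1) (by decide)
      exact Module.Finite.iff_fg.mp (finiteDimensional_range_of_mul_eq_zero (g u) hB hB')
    have : FiniteDimensional ℂ (⨆ u ∈ s, LinearMap.range (g u) : Submodule ℂ M) :=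
      Module.Finite.iff_fg.mpr hfg
    refine Submodule.finiteDimensional_of_le (S₂ := ⨆ u ∈ s, LinearMap.range (g u)) ?_
    refine Submodule.span_le.mpr ?_
    rintro _ ⟨x, hx, w, hw, rfl⟩
    have hle : Submodule.span ℂ (s : Set M) ≤
        (⨆ u ∈ s, LinearMap.range (g u)).comap (ρ x) := by
      refine Submodule.span_le.mpr fun u hu => ?_
      refine Submodule.mem_iSup_of_mem u (Submodule.mem_iSup_of_mem hu
        ⟨coef (-1) (x.op : SAssoc q), ?_⟩)
      change ρ (zf hq (-1) (by decide) (coef (-1) (x.op : SAssoc q))) u = _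
      rw [← eq_zf hq (by decide) hx]
    exact hle (hs.symm ▸ hw)

theorem isQuasifinite_of_killsHighestWeightVector {b : ℂ[X]} (hb : b ≠ 0)
    (hkill : KillsHighestWeightVector hq Λ b) : IsQuasifinite Λ := by
  intro j
  have hle := irrPiece_le_descendPiece Λ (isLocallyGenerated_gradation hq) j
  rcases lt_or_ge 0 j with hj | hj
  · rw [descendPiece_of_pos _ hj, le_bot_iff] at hle
    rw [hle]; infer_instance
  · obtain ⟨n, rfl⟩ : ∃ n : ℕ, j = -n := ⟨(-j).toNat, by omega⟩
    have := finiteDimensional_descend hq (envRep (Irr Λ)) (v := hwVector Λ) (fun k hk => by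
      obtain ⟨m, rfl⟩ : ∃ m : ℕ, k = -1 - m := ⟨(-k - 1).toNat, by omega⟩
      exact exists_zf_mul_smul_hwVector hq hb hkill m) n
    exact Submodule.finiteDimensional_of_le (hle.trans (descendPiece_le_descend _ n))

theorem isQuasifinite_iff_exists_satisfiesEquation :
    IsQuasifinite Λ ↔ ∃ b : ℂ[X], b ≠ 0 ∧ SatisfiesEquation hq Λ b := by
  simp only [← killsHighestWeightVector_iff]
  exact ⟨fun h => h.exists_killsHighestWeightVector hq,
    fun ⟨_, hb, h⟩ => isQuasifinite_of_killsHighestWeightVector hq hb h⟩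

theorem exists_satisfiesEquation_iff_quasipolynomial :
    (∃ b : ℂ[X], b ≠ 0 ∧ SatisfiesEquation hq Λ b) ↔ ∃ P : ℂ → ℂ, IsQuasipolynomial P ∧
      (∀ (n : ℤ) (hn : n ≠ 0), (1 - (q : ℂ) ^ n) * label hq Λ n hn = P n) ∧
      centralCharge Λ = P 0 := by
  simp only [satisfiesEquation_iff]
  constructor
  · rintro ⟨b, hb, h⟩
    obtain ⟨P, hP, hP'⟩ := exists_quasipolynomial_of_recurrence hb h
    refine ⟨P, hP, fun n hn => ?_, ?_⟩
    · rw [← labelSeq_of_ne, hP']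
    · rw [← labelSeq_zero hq, hP', Int.cast_zero]
  · rintro ⟨P, hP, h1, h2⟩
    have : labelSeq hq Λ = fun n : ℤ => P n := by
      funext n
      by_cases hn : n = 0
      · rw [hn, labelSeq_zero, h2, Int.cast_zero]
      · rw [labelSeq_of_ne hq Λ hn, h1]
    rw [this]
    exact hP.exists_recurrence

/-- A nonzero subspace of `ℂ[X]` contains exactly one monic polynomial of minimal degree. -/
theorem exists_isMinimalMonic_iff (W : Submodule ℂ ℂ[X]) (hW : ∃ b ≠ 0, b ∈ W) :
    ∃ b : ℂ[X], ∀ b' : ℂ[X], IsMinimalMonic (· ∈ W) b' ↔ b' = b := by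
  classical
  have hmonic : ∀ b ∈ W, b ≠ 0 → ∃ b' ∈ W, b'.Monic ∧ b'.natDegree = b.natDegree := by
    intro b hb hb0
    have hlc : b.leadingCoeff ≠ 0 := leadingCoeff_ne_zero.mpr hb0
    refine ⟨b.leadingCoeff⁻¹ • b, W.smul_mem _ hb, ?_, ?_⟩
    · rw [Monic, leadingCoeff_smul_of_smul_regular _ (IsSMulRegular.of_ne_zero (inv_ne_zero hlc)),
        smul_eq_mul, inv_mul_cancel₀ hlc]
    · exact natDegree_smul _ (inv_ne_zero hlc)
  have hex : ∃ n, ∃ b ∈ W, b.Monic ∧ b.natDegree = n := by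
    obtain ⟨b, hb0, hb⟩ := hW
    obtain ⟨b', h1, h2, -⟩ := hmonic b hb hb0
    exact ⟨_, b', h1, h2, rfl⟩
  obtain ⟨b, hb, hbm, hdeg⟩ := Nat.find_spec hex
  have hmin : ∀ b' : ℂ[X], b'.Monic → b' ∈ W → b.natDegree ≤ b'.natDegree := fun b' h1 h2 => by
    rw [hdeg]; exact Nat.find_min' hex ⟨b', h2, h1, rfl⟩
  refine ⟨b, fun b' => ⟨?_, fun h => h ▸ ⟨hbm, hb, hmin⟩⟩⟩
  rintro ⟨h1, h2, h3⟩
  by_contra hne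
  have hd : b'.natDegree = b.natDegree := le_antisymm (h3 b hbm hb) (hmin b' h1 h2)
  have h0 : b' - b ≠ 0 := sub_ne_zero.mpr hne
  -- The difference of two monic minimizers, made monic, would be an element of smaller degree.
  obtain ⟨d, hd1, hd2, hd3⟩ := hmonic _ (sub_mem h2 hb) h0
  have hlt : (b' - b).degree < b'.degree :=
    degree_sub_lt_left (by rw [degree_eq_natDegree h1.ne_zero, degree_eq_natDegree hbm.ne_zero, hd])
      h1.ne_zero (by rw [h1.leadingCoeff, hbm.leadingCoeff])
  have hlt' := natDegree_lt_natDegree h0 hlt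
  have := h3 d hd2 hd1
  omega

theorem exists_isMinimalMonic_satisfiesEquation_iff
    (h : ∃ b : ℂ[X], b ≠ 0 ∧ SatisfiesEquation hq Λ b) :
    ∃ b : ℂ[X], ∀ b' : ℂ[X], IsMinimalMonic (SatisfiesEquation hq Λ) b' ↔ b' = b := by
  let W : Submodule ℂ ℂ[X] :=
    LinearMap.ker (LinearMap.applyₗ (labelSeq hq Λ) ∘ₗ (aeval shift).toLinearMap)
  have hW : (· ∈ W) = SatisfiesEquation hq Λ := by
    funext b
    rw [satisfiesEquation_iff]
    rfl
  rw [← hW]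
  refine exists_isMinimalMonic_iff W ?_
  obtain ⟨b, hb, hb'⟩ := h
  exact ⟨b, hb, (congrFun hW b).mpr hb'⟩

end Quasifinite

end QPDO

end

theorem theorem6p4 (q : ℂˣ) (hq : ∀ n : ℤ, n ≠ 0 → q ^ n ≠ 1)
    (Λ : Module.Dual ℂ (SHat.gradation q 0)) :
    (IsQuasifinite Λ ↔ ∃ b : ℂ[X], b ≠ 0 ∧ SatisfiesEquation hq Λ b) ∧
    (IsQuasifinite Λ ↔ ∃ P : ℂ → ℂ, IsQuasipolynomial P ∧
      (∀ (n : ℤ) (hn : n ≠ 0), (1 - (q : ℂ) ^ n) * label hq Λ n hn = P n) ∧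
      centralCharge Λ = P 0) ∧
    (IsQuasifinite Λ → ∃ b : ℂ[X],
      (∀ b' : ℂ[X], IsMinimalMonic (SatisfiesEquation hq Λ) b' ↔ b' = b) ∧
      (∀ b' : ℂ[X], IsCharacteristicPolynomial hq Λ b' ↔ b' = b)) := by
  refine ⟨isQuasifinite_iff_exists_satisfiesEquation hq,
    (isQuasifinite_iff_exists_satisfiesEquation hq).trans
      (exists_satisfiesEquation_iff_quasipolynomial hq), fun h => ?_⟩
  obtain ⟨b, hb⟩ := exists_isMinimalMonic_satisfiesEquation_iff hq
    ((isQuasifinite_iff_exists_satisfiesEquation hq).mp h)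
  refine ⟨b, hb, fun b' => ?_⟩
  rw [← hb b', IsCharacteristicPolynomial,
    show KillsHighestWeightVector hq Λ = SatisfiesEquation hq Λ from
      funext fun b => propext (killsHighestWeightVector_iff hq Λ b)]
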